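/- For a positive integer $n$, regard $M_n(\mathbb{C})$ as a Frobenius algebra over $\mathbb{C}$ with counit $\operatorname{Tr}$ and comultiplication $\Delta(X)=\sum_{i,j} (XE_{i,j})\otimes E_{j,i}$, where the $E_{i,j}$ are the elementary matrices. For linear maps $S,T\colon M_n(\mathbb{C})\to M_n(\mathbb{C})$, the dual and the convolution product are given by $$T^*(X)=\sum_{i,j}\operatorname{Tr}(X\,T(E_{i,j}))\,E_{j,i},\qquad (S*T)(X)=\sum_{i,j}S(XE_{i,j})\,T(E_{j,i}).$$ A biprojection on $M_n(\mathbb{C})$ is a linear map $T\colon M_n(\mathbb{C})\to M_n(\mathbb{C})$ that is selfdual ($T^*=T$), unital ($T(\mathrm{id})=\mathrm{id}$), idempotent ($T\circ T=T$) and convolution-stable, i.e. $T*T=\lambda T$ for some nonzero $\lambda\in\mathbb{C}$. **Proposition.** Let $1\le n\le 3$. 1. If $T$ is a biprojection on $M_n(\mathbb{C})$ and $T*T=\lambda T$, then $\lambda\in\{1/n,\,1,\,n\}$. 2. There is exactly one biprojection with $\lambda=1/n$, namely the normalized trace map $T(X)=\frac1n\operatorname{Tr}(X)\,\mathrm{id}$,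 and exactly one with $\lambda=n$, namely the identity map $T(X)=X$. 3. For $n=2$ and $n=3$, the set of biprojections with $\lambda=1$ has the cardinality of the continuum; in the coordinates $A_{i,j,k,l}=T(E_{i,j})_{k,l}$ it is an affine algebraic subset of $\mathbb{C}^{n^4}$, whose dimension (the Krull dimension of its coordinate ring) is $2$ for $n=2$ and $6$ for $n=3$. -/

import Mathlib

open scoped TensorProduct

/-- A Frobenius algebra in the category of `k`-vector spaces: a unital algebra which is also a
counital coalgebra (its comultiplication being coassociative), subject to the Frobenius condition
`(id ⊗ m) ∘ (δ ⊗ id) = δ ∘ m = (m ⊗ id) ∘ (id ⊗ δ)`. -/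
structure FrobeniusAlgebra (k A : Type*) [Field k] [Ring A] [Algebra k A]
    extends Coalgebra k A where
  frobenius_left :
    (LinearMap.mul' k A).lTensor A ∘ₗ (TensorProduct.assoc k A A A).toLinearMap ∘ₗ comul.rTensor A
      = comul ∘ₗ LinearMap.mul' k A
  frobenius_right :
    (LinearMap.mul' k A).rTensor A ∘ₗ (TensorProduct.assoc k A A A).symm.toLinearMap ∘ₗ
      comul.lTensor A = comul ∘ₗ LinearMap.mul' k A

namespace FrobeniusAlgebra

variable {k A : Type*} [Field k] [Ring A] [Algebra k A] (F : FrobeniusAlgebra k A)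

/-- The evaluation `ev = ε ∘ m : A ⊗ A → k`. -/
noncomputable def ev : A ⊗[k] A →ₗ[k] k :=
  F.counit ∘ₗ LinearMap.mul' k A

/-- The coevaluation `coev = δ ∘ e : k → A ⊗ A`. -/
noncomputable def coev : k →ₗ[k] A ⊗[k] A :=
  F.comul ∘ₗ Algebra.linearMap k A

/-- The dual `f* = (ev ⊗ id) ∘ (id ⊗ f ⊗ id) ∘ (id ⊗ coev)` of an endomorphism `f`. -/
noncomputable def dual (f : A →ₗ[k] A) : A →ₗ[k] A :=
  (TensorProduct.lid k A).toLinearMap ∘ₗ F.ev.rTensor A ∘ₗ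
    (TensorProduct.assoc k A A A).symm.toLinearMap ∘ₗ
    (f.rTensor A).lTensor A ∘ₗ F.coev.lTensor A ∘ₗ (TensorProduct.rid k A).symm.toLinearMap

/-- The convolution product `f * g = m ∘ (f ⊗ g) ∘ δ`. -/
noncomputable def conv (f g : A →ₗ[k] A) : A →ₗ[k] A :=
  LinearMap.mul' k A ∘ₗ TensorProduct.map f g ∘ₗ F.comul

/-- A biprojection: a selfdual unital idempotent endomorphism `b` that is convolution-stable,
i.e. `b * b = c b` (convolution product) for some nonzero scalar `c`. -/
structure IsBiprojection (b : A →ₗ[k] A) : Prop where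
  selfdual : F.dual b = b
  unital : b 1 = 1
  idempotent : b ∘ₗ b = b
  convStable : ∃ c : k, c ≠ 0 ∧ F.conv b b = c • b

end FrobeniusAlgebra

/-- The comultiplication `X ↦ ∑ i j, (X E_{ij}) ⊗ E_{ji}` of `M_n(ℂ)`, where the `E_{ij}` are the
elementary matrices. -/
noncomputable def matrixComul (n : ℕ) :
    Matrix (Fin n) (Fin n) ℂ →ₗ[ℂ] Matrix (Fin n) (Fin n) ℂ ⊗[ℂ] Matrix (Fin n) (Fin n) ℂ :=
  ∑ i : Fin n, ∑ j : Fin n,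
    (TensorProduct.mk ℂ _ _).flip (Matrix.single j i 1) ∘ₗ
      LinearMap.mulRight ℂ (Matrix.single i j (1 : ℂ))

theorem matrixComul_apply {n : ℕ} (X : Matrix (Fin n) (Fin n) ℂ) :
    matrixComul n X = ∑ i : Fin n, ∑ j : Fin n,
      (X * Matrix.single i j 1) ⊗ₜ[ℂ] Matrix.single j i (1 : ℂ) := by
  simp [matrixComul]

theorem single_mul_single_one {n : ℕ} (i j k l : Fin n) :
    Matrix.single i j (1 : ℂ) * Matrix.single k l 1 = if j = k then Matrix.single i l 1 else 0 := by
  split_ifs with h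
  · subst h; simp
  · simp [h]

theorem matrixComul_mul {n : ℕ} (X Y : Matrix (Fin n) (Fin n) ℂ) :
    matrixComul n (X * Y) = ∑ i : Fin n, ∑ j : Fin n,
      (X * Matrix.single i j 1) ⊗ₜ[ℂ] (Matrix.single j i (1 : ℂ) * Y) := by
  have hY : Y = ∑ k : Fin n, ∑ l : Fin n, Y k l • Matrix.single k l (1 : ℂ) := by
    conv_lhs => rw [Matrix.matrix_eq_sum_single Y]
    simp [Matrix.smul_single]
  rw [matrixComul_apply]
  have h1 : ∀ i j : Fin n, (X * Y * Matrix.single i j 1) ⊗ₜ[ℂ] Matrix.single j i (1 : ℂ) =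
      ∑ k, Y k i • ((X * Matrix.single k j 1) ⊗ₜ[ℂ] Matrix.single j i (1 : ℂ)) := by
    intro i j
    conv_lhs => rw [hY]
    simp [-Matrix.smul_single, mul_assoc, Finset.sum_mul, Finset.mul_sum, single_mul_single_one,
      TensorProduct.sum_tmul, TensorProduct.smul_tmul']
  have h2 : ∀ i j : Fin n, (X * Matrix.single i j 1) ⊗ₜ[ℂ] (Matrix.single j i (1 : ℂ) * Y) =
      ∑ l, Y i l • ((X * Matrix.single i j 1) ⊗ₜ[ℂ] Matrix.single j l (1 : ℂ)) := by
    intro i j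
    conv_lhs => rw [hY]
    simp [-Matrix.smul_single, Finset.mul_sum, single_mul_single_one, TensorProduct.tmul_sum]
  simp only [h1, h2]
  conv_lhs => enter [2, i]; rw [Finset.sum_comm]
  rw [Finset.sum_comm]
  exact Finset.sum_congr rfl fun i _ => Finset.sum_comm

/-- The matrix algebra `M_n(ℂ)` as a Frobenius algebra: the counit is the trace and the
comultiplication is `X ↦ ∑ i j, (X E_{ij}) ⊗ E_{ji}`. -/
noncomputable def matrixFrobenius (n : ℕ) :
    FrobeniusAlgebra ℂ (Matrix (Fin n) (Fin n) ℂ) where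
  comul := matrixComul n
  counit := Matrix.traceLinearMap (Fin n) ℂ ℂ
  coassoc := by
    refine LinearMap.ext fun X => ?_
    have h : ∀ i j : Fin n, matrixComul n (X * Matrix.single i j 1) =
      ∑ k : Fin n, ∑ l : Fin n,
        (X * Matrix.single k l 1) ⊗ₜ[ℂ] (Matrix.single l k (1 : ℂ) * Matrix.single i j 1) :=
      fun i j => matrixComul_mul X (Matrix.single i j 1)
    simp only [LinearMap.comp_apply, matrixComul_apply X, map_sum, LinearMap.rTensor_tmul,
      LinearMap.lTensor_tmul, h, TensorProduct.sum_tmul, LinearEquiv.coe_coe,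
      TensorProduct.assoc_tmul]
    simp only [matrixComul_apply, TensorProduct.tmul_sum]
    have hs : ∀ f : Fin n → Fin n → Fin n → Fin n → Matrix (Fin n) (Fin n) ℂ ⊗[ℂ]
        (Matrix (Fin n) (Fin n) ℂ ⊗[ℂ] Matrix (Fin n) (Fin n) ℂ),
        ∑ i, ∑ j, ∑ k, ∑ l, f i j k l = ∑ k, ∑ l, ∑ i, ∑ j, f i j k l := by
      intro f
      have := Finset.sum_comm (s := (Finset.univ : Finset (Fin n × Fin n)))
        (t := (Finset.univ : Finset (Fin n × Fin n))) (f := fun p q => f p.1 p.2 q.1 q.2)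
      simpa only [Fintype.sum_prod_type] using this
    exact hs _
  rTensor_counit_comp_comul := by
    refine LinearMap.ext fun X => ?_
    simp only [LinearMap.comp_apply, matrixComul_apply, map_sum, LinearMap.rTensor_tmul]
    have h : ∀ i j : Fin n, Matrix.traceLinearMap (Fin n) ℂ ℂ (X * Matrix.single i j 1) ⊗ₜ[ℂ]
        Matrix.single j i (1 : ℂ) = 1 ⊗ₜ[ℂ] Matrix.single j i (X j i) := by
      intro i j
      rw [← mul_one (Matrix.traceLinearMap _ _ _ _), ← smul_eq_mul, TensorProduct.smul_tmul]
      simp [Matrix.trace_mul_single, Matrix.smul_single]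
    simp only [h, ← TensorProduct.tmul_sum]
    rw [Finset.sum_comm, ← Matrix.matrix_eq_sum_single X]
    rfl
  lTensor_counit_comp_comul := by
    refine LinearMap.ext fun X => ?_
    simp only [LinearMap.comp_apply, matrixComul_apply, map_sum, LinearMap.lTensor_tmul]
    have h : ∀ i j : Fin n, (X * Matrix.single i j 1) ⊗ₜ[ℂ]
        Matrix.traceLinearMap (Fin n) ℂ ℂ (Matrix.single j i (1 : ℂ)) =
        if i = j then (X * Matrix.single i j 1) ⊗ₜ[ℂ] (1 : ℂ) else 0 := by
      intro i j
      split_ifs with hij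
      · subst hij; simp
      · simp [Matrix.trace_single_eq_of_ne j i (1 : ℂ) (Ne.symm hij)]
    simp only [h, Finset.sum_ite_eq, Finset.mem_univ, if_true]
    rw [← TensorProduct.sum_tmul, ← Finset.mul_sum, Matrix.sum_single_one, mul_one]
    rfl
  frobenius_left := by
    refine TensorProduct.ext' fun X Y => ?_
    simp [matrixComul_apply X, matrixComul_mul, TensorProduct.sum_tmul]
  frobenius_right := by
    refine TensorProduct.ext' fun X Y => ?_
    simp [matrixComul_apply, mul_assoc, TensorProduct.tmul_sum]

/-- The coordinates `A_{i,j,k,l} = T(E_{ij})_{kl}` of an endomorphism `T` of `M_n(ℂ)`; they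
identify `End(M_n(ℂ))` with the affine space of dimension `n ^ 4`. -/
def endCoords {n : ℕ} (T : Matrix (Fin n) (Fin n) ℂ →ₗ[ℂ] Matrix (Fin n) (Fin n) ℂ) :
    Fin n × Fin n × Fin n × Fin n → ℂ :=
  fun p => T (Matrix.single p.1 p.2.1 1) p.2.2.1 p.2.2.2

/-- The set of the biprojections `T` on `M_n(ℂ)` with `T * T = c T` (convolution product). -/
def biprojectionSet (n : ℕ) (c : ℂ) :
    Set (Matrix (Fin n) (Fin n) ℂ →ₗ[ℂ] Matrix (Fin n) (Fin n) ℂ) :=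
  {T | (matrixFrobenius n).IsBiprojection T ∧ (matrixFrobenius n).conv T T = c • T}

/-- `S` is an affine algebraic set: the set of common zeros of some set of polynomials. -/
def IsAffineAlgebraicSet {ι : Type*} (S : Set (ι → ℂ)) : Prop :=
  ∃ P : Set (MvPolynomial ι ℂ), S = {x | ∀ p ∈ P, MvPolynomial.eval x p = 0}

/-- The dimension of an affine algebraic set: the Krull dimension of its coordinate ring, i.e. of
the polynomial ring modulo the ideal of the polynomials that vanish on the set. -/
noncomputable def affineDim {ι : Type*} (S : Set (ι → ℂ)) : WithBot ℕ∞ :=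
  ringKrullDim (MvPolynomial ι ℂ ⧸ MvPolynomial.vanishingIdeal ℂ S)

/-! Let T be a biprojection with T * T = λT. Selfduality makes T symmetric for the trace form;
evaluating T * T = λT at 1 and taking traces then gives rank T = λn. The Choi matrix turns
convolution into the matrix product, so λ⁻¹ times it is idempotent, and its trace n/λ is a natural
number. Hence rank T divides n², and for n = 1 or n prime it is 1, n or n² (`exists_dvd`,
`scalar_cases`). Rank 1 leaves only scalar matrices as values; rank n² forces T = id.

For λ = 1 and n = 2, 3, the biprojections are exactly the maps X ↦ ∑ Tr(e_s X) e_s, where e_1, …,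
e_n are orthogonal idempotents of rank one. Indeed the traceless part of the range has dimension n -
1 and a nondegenerate trace form. It is spanned by some b with b² = 1 if n = 2, and by y and y² with
y³ = 1 if n = 3; the e_s are the spectral projections of b or y (`exists_eq_columnProjection_two`,
`exists_eq_columnProjection_three`).

Such a family comes from an invertible matrix, up to scaling and permuting its columns, so the
diagonal can be normalized to 1, which leaves n² - n parameters. Let D be the determinant of the
generic normalized matrix. The coordinate ring embeds in ℂ[x][1/D], which is algebraic over it:
entries of the e_s are eigenvalues of matrices of coordinates, and each variable is a quotient of
two such entries. So the transcendence degree, hence the Krull dimension, is n² - n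
(`affineDim_image_endCoords`). Transvections give continuum many biprojections, and for λ = 1 the
axioms are polynomial equations. -/

/-! ### Krull dimension and transcendence degree. -/

/-- Lying over and going up lift chains of primes to S; incomparability makes contraction to R
strictly monotone. -/
theorem ringKrullDim_eq_of_isIntegral_of_injective (R S : Type*) [CommRing R] [CommRing S]
    [Algebra R S] [Algebra.IsIntegral R S] (h : Function.Injective (algebraMap R S)) :
    ringKrullDim R = ringKrullDim S := by
  apply le_antisymm
  · refine iSup_le fun l => ?_
    obtain ⟨Q, -, hQ, hQl⟩ := Ideal.exists_ideal_over_prime_of_isIntegral l.head.asIdeal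
      (⊥ : Ideal S) (by
        rw [← RingHom.ker_eq_comap_bot, (RingHom.injective_iff_ker_eq_bot _).mp h]; exact bot_le)
    have : Q.LiesOver l.head.asIdeal := ⟨hQl.symm⟩
    obtain ⟨L, hL, -, -⟩ := Ideal.exists_ltSeries_of_hasGoingUp l Q
    rw [← hL]
    exact Order.LTSeries.length_le_krullDim L
  · exact Order.krullDim_le_of_strictMono (PrimeSpectrum.comap (algebraMap R S))
      fun P Q hPQ => Ideal.IsIntegral.comap_lt_comap (R := R) (I := P.asIdeal) (J := Q.asIdeal) hPQ

/-- By Noether normalization, A is integral over a polynomial ring, whose number of variables must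
be d. -/
theorem ringKrullDim_eq_of_trdeg_eq (k A : Type*) [Field k] [CommRing A] [IsDomain A] [Algebra k A]
    [Algebra.FiniteType k A] (d : ℕ) (hd : Algebra.trdeg k A = d) : ringKrullDim A = d := by
  obtain ⟨s, g, hg, hint⟩ := exists_integral_inj_algHom_of_fg k A
  algebraize [g.toRingHom]
  have hinj : Function.Injective (algebraMap (MvPolynomial (Fin s) k) A) := hg
  have : Algebra.IsIntegral (MvPolynomial (Fin s) k) A := ⟨hint⟩
  have : FaithfulSMul (MvPolynomial (Fin s) k) A :=
    (faithfulSMul_iff_algebraMap_injective _ _).mpr hinj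
  have h1 := lift_trdeg_add_eq k (MvPolynomial (Fin s) k) A
  rw [trdeg_eq_zero (R := MvPolynomial (Fin s) k), hd] at h1
  have hs : s = d := by simpa using h1
  rw [← ringKrullDim_eq_of_isIntegral_of_injective _ A hinj, ← hs]
  simp

section Matrices

open Matrix

/-! ### Convolution, the trace form and the possible constants. -/

section Convolution

variable {n : ℕ}

theorem sum_trace_mul_single_smul (X : Matrix (Fin n) (Fin n) ℂ) :
    ∑ i, ∑ j, (X * single i j 1).trace • single j i (1 : ℂ) = X := by
  conv_rhs => rw [matrix_eq_sum_single X, Finset.sum_comm]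
  simp [trace_mul_single]

theorem matrixFrobenius_conv_apply (S T : Matrix (Fin n) (Fin n) ℂ →ₗ[ℂ] Matrix (Fin n) (Fin n) ℂ) (X : Matrix (Fin n) (Fin n) ℂ) :
    (matrixFrobenius n).conv S T X =
      ∑ i, ∑ j, S (X * single i j 1) * T (single j i 1) := by
  change (LinearMap.mul' ℂ (Matrix (Fin n) (Fin n) ℂ) ∘ₗ TensorProduct.map S T ∘ₗ matrixComul n) X = _
  simp [matrixComul_apply]

theorem matrixFrobenius_dual_apply (T : Matrix (Fin n) (Fin n) ℂ →ₗ[ℂ] Matrix (Fin n) (Fin n) ℂ) (X : Matrix (Fin n) (Fin n) ℂ) :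
    (matrixFrobenius n).dual T X = ∑ i, ∑ j, (X * T (single i j 1)).trace • single j i 1 := by
  have h1 : (matrixFrobenius n).coev 1 =
      ∑ i, ∑ j, single i j (1 : ℂ) ⊗ₜ[ℂ] single j i (1 : ℂ) := by
    change matrixComul n (algebraMap ℂ (Matrix (Fin n) (Fin n) ℂ) 1) = _
    rw [map_one, matrixComul_apply]
    simp
  have h2 (A B : Matrix (Fin n) (Fin n) ℂ) : (matrixFrobenius n).ev (A ⊗ₜ[ℂ] B) = (A * B).trace := by
    change Matrix.traceLinearMap (Fin n) ℂ ℂ (LinearMap.mul' ℂ (Matrix (Fin n) (Fin n) ℂ) (A ⊗ₜ[ℂ] B)) = _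
    simp
  simp [FrobeniusAlgebra.dual, h1, TensorProduct.tmul_sum, h2]

theorem trace_matrixFrobenius_dual_mul (T : Matrix (Fin n) (Fin n) ℂ →ₗ[ℂ] Matrix (Fin n) (Fin n) ℂ) (X Y : Matrix (Fin n) (Fin n) ℂ) :
    ((matrixFrobenius n).dual T X * Y).trace = (X * T Y).trace := by
  rw [matrixFrobenius_dual_apply]
  conv_rhs => rw [← sum_trace_mul_single_smul Y]
  rw [Finset.sum_comm]
  simp [Finset.sum_mul, Finset.mul_sum, trace_sum, mul_comm, trace_single_mul,
    trace_mul_single, -smul_single]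

/-- The dual is the adjoint for the trace form, and that form is nondegenerate. -/
theorem matrixFrobenius_dual_eq_self_iff (T : Matrix (Fin n) (Fin n) ℂ →ₗ[ℂ] Matrix (Fin n) (Fin n) ℂ) :
    (matrixFrobenius n).dual T = T ↔ ∀ X Y, (T X * Y).trace = (X * T Y).trace := by
  constructor
  · intro h X Y
    rw [← trace_matrixFrobenius_dual_mul, h]
  · intro h
    ext1 X
    rw [ext_iff_trace_mul_right]
    intro Y
    rw [trace_matrixFrobenius_dual_mul, h]

/-- The sum over elementary matrices collapses because ∑ Tr(b_s X E_ij) E_ji = b_s X. -/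
theorem matrixFrobenius_conv_eq_sum {ι : Type*} [Fintype ι] (S T : Matrix (Fin n) (Fin n) ℂ →ₗ[ℂ] Matrix (Fin n) (Fin n) ℂ) (a b : ι → Matrix (Fin n) (Fin n) ℂ)
    (hS : ∀ X, S X = ∑ s, (b s * X).trace • a s) (X : Matrix (Fin n) (Fin n) ℂ) :
    (matrixFrobenius n).conv S T X = ∑ s, a s * T (b s * X) := by
  simp_rw [matrixFrobenius_conv_apply, hS, Finset.sum_mul, ← mul_assoc]
  simp_rw [fun i => Finset.sum_comm (s := (Finset.univ : Finset (Fin n))) (t := Finset.univ)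
    (f := fun j s => (b s * X * single i j 1).trace • a s * T (single j i 1))]
  rw [Finset.sum_comm]
  refine Finset.sum_congr rfl fun s _ => ?_
  conv_rhs => rw [← sum_trace_mul_single_smul (b s * X)]
  simp only [map_sum, map_smul, Finset.mul_sum, smul_mul_assoc, mul_smul_comm]

/-- The Choi matrix of `T`; it turns convolution into the matrix product. -/
def choiMatrix (T : Matrix (Fin n) (Fin n) ℂ →ₗ[ℂ] Matrix (Fin n) (Fin n) ℂ) : Matrix (Fin n × Fin n) (Fin n × Fin n) ℂ :=
  fun p q => T (single p.2 q.2 1) p.1 q.1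

theorem choiMatrix_conv (S T : Matrix (Fin n) (Fin n) ℂ →ₗ[ℂ] Matrix (Fin n) (Fin n) ℂ) :
    choiMatrix ((matrixFrobenius n).conv S T) = choiMatrix S * choiMatrix T := by
  ext ⟨k, a⟩ ⟨l, b⟩
  simp only [choiMatrix, mul_apply, Fintype.sum_prod_type, matrixFrobenius_conv_apply,
    Matrix.sum_apply, single_mul_single_one]
  rw [Finset.sum_comm' (t' := Finset.univ) (s' := fun _ => Finset.univ) (by simp)]
  simp only [apply_ite S, map_zero]
  rw [Finset.sum_comm]
  rw [Finset.sum_eq_single b]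
  · rw [Finset.sum_comm]; simp
  · intro i _ hi
    simp [hi.symm]
  · simp

theorem trace_eq_sum_apply_single (T : Matrix (Fin n) (Fin n) ℂ →ₗ[ℂ] Matrix (Fin n) (Fin n) ℂ) :
    LinearMap.trace ℂ (Matrix (Fin n) (Fin n) ℂ) T = ∑ i, ∑ j, T (single i j 1) i j := by
  rw [LinearMap.trace_eq_matrix_trace ℂ (Matrix.stdBasis ℂ (Fin n) (Fin n)), Matrix.trace,
    Fintype.sum_prod_type]
  refine Finset.sum_congr rfl fun i _ => Finset.sum_congr rfl fun j _ => ?_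
  rw [diag_apply, LinearMap.toMatrix_apply, stdBasis_eq_single]
  rfl

theorem trace_choiMatrix (T : Matrix (Fin n) (Fin n) ℂ →ₗ[ℂ] Matrix (Fin n) (Fin n) ℂ) : (choiMatrix T).trace = (T 1).trace := by
  rw [← sum_single_one, map_sum, trace_sum, Matrix.trace, Fintype.sum_prod_type, Finset.sum_comm]
  rfl

theorem trace_eq_finrank_range {V : Type*} [AddCommGroup V] [Module ℂ V] [FiniteDimensional ℂ V]
    {f : V →ₗ[ℂ] V} (hf : f ∘ₗ f = f) :
    LinearMap.trace ℂ V f = Module.finrank ℂ (LinearMap.range f) :=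
  (LinearMap.IsIdempotentElem.isProj_range f hf).trace

theorem exists_nat_eq_trace_of_mul_self_eq {ι : Type*} [Fintype ι] [DecidableEq ι]
    {A : Matrix ι ι ℂ} (hA : A * A = A) : ∃ d : ℕ, A.trace = d := by
  rw [← trace_toLin'_eq A]
  exact ⟨_, trace_eq_finrank_range (by rw [← toLin'_mul, hA])⟩

namespace FrobeniusAlgebra.IsBiprojection

variable {T : Matrix (Fin n) (Fin n) ℂ →ₗ[ℂ] Matrix (Fin n) (Fin n) ℂ}

theorem apply_apply (hT : (matrixFrobenius n).IsBiprojection T) (X : Matrix (Fin n) (Fin n) ℂ) : T (T X) = T X := DFunLike.congr_fun hT.idempotent X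

theorem trace_apply_mul (hT : (matrixFrobenius n).IsBiprojection T) (X Y : Matrix (Fin n) (Fin n) ℂ) : (T X * Y).trace = (X * T Y).trace :=
  (matrixFrobenius_dual_eq_self_iff T).mp hT.selfdual X Y

theorem trace_apply (hT : (matrixFrobenius n).IsBiprojection T) (X : Matrix (Fin n) (Fin n) ℂ) : (T X).trace = X.trace := by
  simpa [hT.unital] using hT.trace_apply_mul X 1

theorem trace_eq (hT : (matrixFrobenius n).IsBiprojection T) {c : ℂ} (hc : (matrixFrobenius n).conv T T = c • T) :
    LinearMap.trace ℂ (Matrix (Fin n) (Fin n) ℂ) T = c * n := by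
  have h := congrArg Matrix.trace (DFunLike.congr_fun hc 1)
  rw [matrixFrobenius_conv_apply, LinearMap.smul_apply, hT.unital] at h
  -- Symmetry and idempotence turn Tr(T(E_ij) T(E_ji)) into Tr(E_ij T(E_ji)), a diagonal coefficient
  -- of T.
  simp only [one_mul, trace_sum, hT.trace_apply_mul, hT.apply_apply, trace_smul, trace_one,
    Fintype.card_fin, smul_eq_mul] at h
  rw [← h, trace_eq_sum_apply_single, Finset.sum_comm]
  simp [trace_single_mul]

theorem finrank_range_eq (hT : (matrixFrobenius n).IsBiprojection T) {c : ℂ} (hc : (matrixFrobenius n).conv T T = c • T) :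
    (Module.finrank ℂ (LinearMap.range T) : ℂ) = c * n := by
  rw [← hT.trace_eq hc, trace_eq_finrank_range hT.idempotent]

theorem scalar_ne_zero [NeZero n] (hT : (matrixFrobenius n).IsBiprojection T) {c : ℂ} (hc : (matrixFrobenius n).conv T T = c • T) : c ≠ 0 := by
  obtain ⟨d, hd, hd'⟩ := hT.convStable
  have h1 : d • T 1 = c • T 1 := DFunLike.congr_fun (hd'.symm.trans hc) 1
  rw [hT.unital] at h1
  rwa [← smul_left_injective ℂ one_ne_zero h1]

/-- The constant of a biprojection on `M_n(ℂ)` is `r / n` for a divisor `r` of `n ^ 2`. -/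
theorem exists_dvd [NeZero n] (hT : (matrixFrobenius n).IsBiprojection T) {c : ℂ} (hc : (matrixFrobenius n).conv T T = c • T) :
    ∃ r : ℕ, r ∣ n ^ 2 ∧ c = r / n := by
  have hn : (n : ℂ) ≠ 0 := NeZero.ne _
  have hc0 := hT.scalar_ne_zero hc
  have hsq : choiMatrix T * choiMatrix T = c • choiMatrix T := by
    rw [← choiMatrix_conv, hc]
    rfl
  obtain ⟨d, hd⟩ := exists_nat_eq_trace_of_mul_self_eq (A := c⁻¹ • choiMatrix T) (by
    rw [smul_mul_smul_comm, hsq, smul_smul]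
    congr 1
    field_simp)
  rw [trace_smul, trace_choiMatrix, hT.unital, trace_one, Fintype.card_fin, smul_eq_mul] at hd
  refine ⟨_, ⟨d, ?_⟩, (eq_div_of_mul_eq hn (hT.finrank_range_eq hc).symm)⟩
  have : ((n ^ 2 : ℕ) : ℂ) = (Module.finrank ℂ (LinearMap.range T) * d : ℕ) := by
    push_cast
    rw [hT.finrank_range_eq hc, ← hd]
    field_simp
  exact_mod_cast this

theorem scalar_cases (hT : (matrixFrobenius n).IsBiprojection T) (hn : n = 1 ∨ n.Prime) {c : ℂ}
    (hc : (matrixFrobenius n).conv T T = c • T) : c = 1 / (n : ℂ) ∨ c = 1 ∨ c = (n : ℂ) := by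
  have : NeZero n := ⟨by rintro rfl; simp [Nat.not_prime_zero] at hn⟩
  have hn0 : (n : ℂ) ≠ 0 := NeZero.ne _
  obtain ⟨r, hr, rfl⟩ := hT.exists_dvd hc
  rcases hn with rfl | hp
  · simp_all
  obtain ⟨i, hi, rfl⟩ := (Nat.dvd_prime_pow hp).mp hr
  interval_cases i
  · simp
  · right; left; simp [hn0]
  · right; right; push_cast; field_simp

theorem eq_trace_of_scalar_eq [NeZero n] (hT : (matrixFrobenius n).IsBiprojection T) (hc : (matrixFrobenius n).conv T T = (1 / (n : ℂ)) • T)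
    (X : Matrix (Fin n) (Fin n) ℂ) : T X = ((1 / (n : ℂ)) * X.trace) • 1 := by
  have hn : (n : ℂ) ≠ 0 := NeZero.ne _
  have hr : Module.finrank ℂ (LinearMap.range T) = 1 := by
    have := hT.finrank_range_eq hc
    rw [one_div_mul_cancel hn] at this
    exact_mod_cast this
  obtain ⟨a, ha⟩ := (finrank_eq_one_iff_of_nonzero' (⟨1, 1, hT.unital⟩ : LinearMap.range T)
    (by simp [Subtype.ext_iff])).mp hr ⟨T X, X, rfl⟩
  have ha' : a • (1 : Matrix (Fin n) (Fin n) ℂ) = T X := congrArg Subtype.val ha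
  have := hT.trace_apply X
  rw [← ha', trace_smul, trace_one, Fintype.card_fin, smul_eq_mul] at this
  rw [← ha', ← this]
  congr 1
  field_simp

theorem eq_id_of_scalar_eq (hT : (matrixFrobenius n).IsBiprojection T) (hc : (matrixFrobenius n).conv T T = (n : ℂ) • T) (X : Matrix (Fin n) (Fin n) ℂ) :
    T X = X := by
  have hr : Module.finrank ℂ (LinearMap.range T) = Module.finrank ℂ (Matrix (Fin n) (Fin n) ℂ) := by
    have := hT.finrank_range_eq hc
    rw [Module.finrank_matrix]
    simp only [Fintype.card_fin, Module.finrank_self, mul_one]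
    exact_mod_cast this
  obtain ⟨Y, rfl⟩ : X ∈ LinearMap.range T := by
    rw [Submodule.eq_top_of_finrank_eq hr]; trivial
  exact hT.apply_apply Y

end FrobeniusAlgebra.IsBiprojection

theorem trace_mem_biprojectionSet [NeZero n] :
    (1 / (n : ℂ)) • (traceLinearMap (Fin n) ℂ ℂ).smulRight (1 : Matrix (Fin n) (Fin n) ℂ) ∈
      biprojectionSet n (1 / (n : ℂ)) := by
  have hn : (n : ℂ) ≠ 0 := NeZero.ne _
  have hconv : (matrixFrobenius n).conv
      ((1 / (n : ℂ)) • (traceLinearMap (Fin n) ℂ ℂ).smulRight (1 : Matrix (Fin n) (Fin n) ℂ))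
      ((1 / (n : ℂ)) • (traceLinearMap (Fin n) ℂ ℂ).smulRight (1 : Matrix (Fin n) (Fin n) ℂ)) =
      (1 / (n : ℂ)) • (1 / (n : ℂ)) • (traceLinearMap (Fin n) ℂ ℂ).smulRight (1 : Matrix (Fin n) (Fin n) ℂ) := by
    ext1 X
    rw [matrixFrobenius_conv_eq_sum (ι := Unit) _ _ (fun _ => (1 / (n : ℂ)) • 1) (fun _ => 1)
      (fun X => by simp [smul_smul, mul_comm])]
    simp [smul_smul, mul_comm, mul_left_comm]
  refine ⟨⟨?_, ?_, ?_, _, one_div_ne_zero hn, hconv⟩, hconv⟩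
  · rw [matrixFrobenius_dual_eq_self_iff]
    intro X Y
    simp [mul_comm]
  · simp [smul_smul, hn]
  · ext1 X
    simp [smul_smul, hn, mul_comm]

theorem id_mem_biprojectionSet [NeZero n] :
    (LinearMap.id : Matrix (Fin n) (Fin n) ℂ →ₗ[ℂ] Matrix (Fin n) (Fin n) ℂ) ∈ biprojectionSet n (n : ℂ) := by
  have hn : (n : ℂ) ≠ 0 := NeZero.ne _
  have hconv : (matrixFrobenius n).conv (LinearMap.id : Matrix (Fin n) (Fin n) ℂ →ₗ[ℂ] Matrix (Fin n) (Fin n) ℂ) LinearMap.id =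
      (n : ℂ) • LinearMap.id := by
    ext1 X
    simp [matrixFrobenius_conv_apply, mul_assoc, ← Finset.mul_sum, sum_single_one]
    rw [← nsmul_eq_mul, Nat.cast_smul_eq_nsmul]
  refine ⟨⟨?_, rfl, rfl, _, hn, hconv⟩, hconv⟩
  rw [matrixFrobenius_dual_eq_self_iff]
  simp

end Convolution

/-! ### Projections attached to orthogonal idempotents of rank one. -/

section Structure

variable {n : ℕ}

/-- The idempotent of rank one attached to the `s`-th column of an invertible matrix. -/
noncomputable def columnIdempotent {R : Type*} [CommRing R] (g : Matrix (Fin n) (Fin n) R)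
    (s : Fin n) : Matrix (Fin n) (Fin n) R :=
  vecMulVec (g.col s) (g⁻¹.row s)

theorem columnIdempotent_apply {R : Type*} [CommRing R] (g : Matrix (Fin n) (Fin n) R)
    (s i j : Fin n) : columnIdempotent g s i j = g i s * g⁻¹ s j := rfl

/-- Each e_i fixes a nonzero vector v_i. Applying e_i to a linear relation isolates its i-th
coefficient, so the v_i are the columns of an invertible g, and e_s g = g E_ss. -/
theorem exists_eq_columnIdempotent {e : Fin n → Matrix (Fin n) (Fin n) ℂ}
    (he : ∀ i j, e i * e j = if i = j then e i else 0) (h0 : ∀ i, e i ≠ 0) :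
    ∃ g : Matrix (Fin n) (Fin n) ℂ, IsUnit g ∧ ∀ s, e s = columnIdempotent g s := by
  have hv (i : Fin n) : ∃ v, v ≠ 0 ∧ e i *ᵥ v = v := by
    by_contra! h
    apply h0 i
    rw [← mulVec_injective.eq_iff]
    funext w
    rw [zero_mulVec]
    by_contra hw
    exact h _ hw (by rw [mulVec_mulVec, he, if_pos rfl])
  choose v hv0 hv using hv
  have hev (i j : Fin n) : e i *ᵥ v j = if i = j then v j else 0 := by
    rw [← hv j, mulVec_mulVec, he]
    split_ifs with h
    · rw [h]
    · simp
  have hli : LinearIndependent ℂ v := by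
    rw [Fintype.linearIndependent_iff]
    intro c hc i
    have := congrArg (e i *ᵥ ·) hc
    simpa [mulVec_sum, mulVec_smul, hev, hv0] using this
  set g : Matrix (Fin n) (Fin n) ℂ := (of v)ᵀ with hg
  have hgu : IsUnit g := by
    rw [← linearIndependent_cols_iff_isUnit]
    exact hli
  refine ⟨g, hgu, fun s => ?_⟩
  have h1 : e s * g = g * single s s 1 := by
    ext i j
    have h2 := congrFun (hev s j) i
    have h3 : (e s * g) i j = (e s *ᵥ v j) i := rfl
    rw [h3, h2]
    by_cases hsj : s = j
    · subst hsj
      simp [hg]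
    · rw [if_neg hsj, mul_single_apply_of_ne _ _ _ _ _ (Ne.symm hsj)]
      rfl
  have hdet : IsUnit g.det := (isUnit_iff_isUnit_det _).mp hgu
  rw [← mul_nonsing_inv_cancel_right _ (e s) hdet, h1]
  ext i j
  rw [columnIdempotent_apply, mul_assoc, mul_apply, Finset.sum_eq_single s]
  · simp
  · intro k _ hk
    rw [single_mul_apply_of_ne _ _ _ _ _ hk, mul_zero]
  · simp

/-- The projection `X ↦ ∑ s, Tr(e_s X) e_s`, where the `e_s` are the idempotents of rank one
attached to the columns of `g`. -/
noncomputable def columnProjection (g : Matrix (Fin n) (Fin n) ℂ) :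
    Matrix (Fin n) (Fin n) ℂ →ₗ[ℂ] Matrix (Fin n) (Fin n) ℂ :=
  ∑ s, (traceLinearMap (Fin n) ℂ ℂ ∘ₗ LinearMap.mulLeft ℂ (columnIdempotent g s)).smulRight
    (columnIdempotent g s)

theorem columnProjection_apply (g X : Matrix (Fin n) (Fin n) ℂ) :
    columnProjection g X = ∑ s, (columnIdempotent g s * X).trace • columnIdempotent g s := by
  simp [columnProjection]

section

variable {R : Type*} [CommRing R] {g : Matrix (Fin n) (Fin n) R}

theorem inv_row_dotProduct_col (hg : IsUnit g.det) (s t : Fin n) :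
    g⁻¹.row s ⬝ᵥ g.col t = if s = t then 1 else 0 := by
  change (g⁻¹ * g) s t = _
  rw [nonsing_inv_mul _ hg, one_apply]

theorem columnIdempotent_mul (hg : IsUnit g.det) (s t : Fin n) :
    columnIdempotent g s * columnIdempotent g t = if s = t then columnIdempotent g s else 0 := by
  rw [columnIdempotent, columnIdempotent, vecMulVec_mul_vecMulVec, inv_row_dotProduct_col hg]
  split_ifs with h
  · simp [h]
  · simp

theorem sum_columnIdempotent (hg : IsUnit g.det) : ∑ s, columnIdempotent g s = 1 := by
  rw [← mul_nonsing_inv _ hg]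
  ext i j
  simp [Matrix.sum_apply, columnIdempotent_apply, mul_apply]

theorem trace_columnIdempotent (hg : IsUnit g.det) (s : Fin n) :
    (columnIdempotent g s).trace = 1 := by
  rw [columnIdempotent, trace_vecMulVec, dotProduct_comm, inv_row_dotProduct_col hg, if_pos rfl]

end

theorem columnProjection_columnIdempotent {g : Matrix (Fin n) (Fin n) ℂ} (hg : IsUnit g.det)
    (s : Fin n) : columnProjection g (columnIdempotent g s) = columnIdempotent g s := by
  simp [columnProjection_apply, columnIdempotent_mul hg, apply_ite trace, trace_columnIdempotent hg]

/-- The convolution square has the terms Tr(e_t e_s X) e_s e_t; orthogonality leaves Tr(e_s X) e_s.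
-/
theorem columnProjection_mem_biprojectionSet {g : Matrix (Fin n) (Fin n) ℂ} (hg : IsUnit g.det) :
    columnProjection g ∈ biprojectionSet n 1 := by
  have hconv : (matrixFrobenius n).conv (columnProjection g) (columnProjection g) =
      (1 : ℂ) • columnProjection g := by
    ext1 X
    rw [matrixFrobenius_conv_eq_sum _ _ _ _ (columnProjection_apply g), one_smul]
    simp only [columnProjection_apply, Finset.mul_sum, mul_smul_comm, columnIdempotent_mul hg,
      ← mul_assoc]
    simp [ite_mul, apply_ite trace]
  refine ⟨⟨?_, ?_, ?_, 1, one_ne_zero, hconv⟩, hconv⟩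
  · rw [matrixFrobenius_dual_eq_self_iff]
    intro X Y
    simp only [columnProjection_apply, Finset.sum_mul, Finset.mul_sum, trace_sum, smul_mul_assoc,
      mul_smul_comm, trace_smul, smul_eq_mul]
    refine Finset.sum_congr rfl fun s _ => ?_
    rw [trace_mul_comm X, mul_comm]
  · simp [columnProjection_apply, trace_columnIdempotent hg, sum_columnIdempotent hg]
  · ext1 X
    rw [LinearMap.comp_apply]
    conv_lhs => rw [columnProjection_apply g X]
    simp only [map_sum, map_smul, columnProjection_columnIdempotent hg]
    rw [columnProjection_apply]

end Structure

/-! ### Classification of the biprojections with constant 1 for n = 2 and n = 3. -/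

section Classification

variable {n : ℕ}

/-- The difference of `T` and the normalized trace map. -/
noncomputable def tracelessPart (T : Matrix (Fin n) (Fin n) ℂ →ₗ[ℂ] Matrix (Fin n) (Fin n) ℂ) :
    Matrix (Fin n) (Fin n) ℂ →ₗ[ℂ] Matrix (Fin n) (Fin n) ℂ :=
  T - (1 / (n : ℂ)) • (traceLinearMap (Fin n) ℂ ℂ).smulRight 1

theorem tracelessPart_apply (T : Matrix (Fin n) (Fin n) ℂ →ₗ[ℂ] Matrix (Fin n) (Fin n) ℂ)
    (X : Matrix (Fin n) (Fin n) ℂ) : tracelessPart T X = T X - (X.trace / n) • 1 := by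
  simp [tracelessPart, smul_smul, div_eq_inv_mul]

namespace FrobeniusAlgebra.IsBiprojection

variable {T : Matrix (Fin n) (Fin n) ℂ →ₗ[ℂ] Matrix (Fin n) (Fin n) ℂ}

theorem trace_tracelessPart [NeZero n] (hT : (matrixFrobenius n).IsBiprojection T)
    (X : Matrix (Fin n) (Fin n) ℂ) : (tracelessPart T X).trace = 0 := by
  have hn : (n : ℂ) ≠ 0 := NeZero.ne _
  simp [tracelessPart_apply, hT.trace_apply, hn]

theorem apply_tracelessPart (hT : (matrixFrobenius n).IsBiprojection T)
    (X : Matrix (Fin n) (Fin n) ℂ) : T (tracelessPart T X) = tracelessPart T X := by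
  simp [tracelessPart_apply, hT.apply_apply, hT.unital]

theorem tracelessPart_eq_self_iff [NeZero n] (hT : (matrixFrobenius n).IsBiprojection T)
    {X : Matrix (Fin n) (Fin n) ℂ} : tracelessPart T X = X ↔ T X = X ∧ X.trace = 0 := by
  constructor
  · intro h
    rw [← h]
    exact ⟨hT.apply_tracelessPart X, hT.trace_tracelessPart X⟩
  · rintro ⟨h1, h2⟩
    simp [tracelessPart_apply, h1, h2]

theorem tracelessPart_comp_self [NeZero n] (hT : (matrixFrobenius n).IsBiprojection T) :
    tracelessPart T ∘ₗ tracelessPart T = tracelessPart T := by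
  ext1 X
  exact hT.tracelessPart_eq_self_iff.mpr ⟨hT.apply_tracelessPart X, hT.trace_tracelessPart X⟩

theorem mem_range_tracelessPart_iff [NeZero n] (hT : (matrixFrobenius n).IsBiprojection T)
    {X : Matrix (Fin n) (Fin n) ℂ} :
    X ∈ LinearMap.range (tracelessPart T) ↔ T X = X ∧ X.trace = 0 := by
  rw [← hT.tracelessPart_eq_self_iff]
  constructor
  · rintro ⟨Y, rfl⟩
    exact DFunLike.congr_fun hT.tracelessPart_comp_self Y
  · exact fun h => ⟨X, h⟩

theorem trace_mul_tracelessPart [NeZero n] (hT : (matrixFrobenius n).IsBiprojection T)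
    {X : Matrix (Fin n) (Fin n) ℂ} (hX : X ∈ LinearMap.range (tracelessPart T))
    (Y : Matrix (Fin n) (Fin n) ℂ) : (X * tracelessPart T Y).trace = (X * Y).trace := by
  obtain ⟨h1, h2⟩ := hT.mem_range_tracelessPart_iff.mp hX
  simp [tracelessPart_apply, mul_sub, ← hT.trace_apply_mul, h1, h2]

/-- The rank of a projection is its trace, and subtracting the normalized trace map lowers the trace
from n to n - 1. -/
theorem finrank_range_tracelessPart [NeZero n] (hT : (matrixFrobenius n).IsBiprojection T)
    (hc : (matrixFrobenius n).conv T T = (1 : ℂ) • T) :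
    Module.finrank ℂ (LinearMap.range (tracelessPart T)) + 1 = n := by
  have hn : (n : ℂ) ≠ 0 := NeZero.ne _
  have h := trace_eq_finrank_range hT.tracelessPart_comp_self
  rw [tracelessPart, map_sub, hT.trace_eq hc, map_smul, LinearMap.trace_smulRight] at h
  have h' : (n : ℂ) - 1 = Module.finrank ℂ (LinearMap.range (tracelessPart T)) := by
    rw [tracelessPart, ← h]
    simp [hn]
  have : ((Module.finrank ℂ (LinearMap.range (tracelessPart T)) + 1 : ℕ) : ℂ) = n := by
    push_cast
    rw [← h']
    ring
  exact_mod_cast this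

/-- The trace form is nondegenerate on the traceless part of the range. -/
theorem exists_trace_mul_eq [NeZero n] (hT : (matrixFrobenius n).IsBiprojection T)
    {Y : Matrix (Fin n) (Fin n) ℂ} (hY : Y ∈ LinearMap.range (tracelessPart T)) (h0 : Y ≠ 0)
    (t : ℂ) : ∃ Z ∈ LinearMap.range (tracelessPart T), (Y * Z).trace = t := by
  obtain ⟨X, hX⟩ : ∃ X, (Y * X).trace ≠ 0 := by
    by_contra! h
    exact h0 (ext_iff_trace_mul_right.mpr (by simpa using h))
  refine ⟨(t / (Y * X).trace) • tracelessPart T X, Submodule.smul_mem _ _ ⟨X, rfl⟩, ?_⟩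
  rw [mul_smul_comm, trace_smul, hT.trace_mul_tracelessPart hY, smul_eq_mul, div_mul_cancel₀ _ hX]

end FrobeniusAlgebra.IsBiprojection

theorem exists_eq_columnProjection_of_idempotents
    {T : Matrix (Fin n) (Fin n) ℂ →ₗ[ℂ] Matrix (Fin n) (Fin n) ℂ}
    {e : Fin n → Matrix (Fin n) (Fin n) ℂ} (he : ∀ i j, e i * e j = if i = j then e i else 0)
    (htr : ∀ i, (e i).trace = 1) (hT : ∀ X, T X = ∑ s, (e s * X).trace • e s) :
    ∃ g : Matrix (Fin n) (Fin n) ℂ, IsUnit g.det ∧ T = columnProjection g := by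
  obtain ⟨g, hg, hge⟩ := exists_eq_columnIdempotent he (fun i h => by simpa [h] using htr i)
  refine ⟨g, (isUnit_iff_isUnit_det _).mp hg, ?_⟩
  ext1 X
  rw [hT, columnProjection_apply]
  simp_rw [hge]

theorem exists_eq_columnProjection_of_sq_eq_one
    {T : Matrix (Fin 2) (Fin 2) ℂ →ₗ[ℂ] Matrix (Fin 2) (Fin 2) ℂ}
    {b : Matrix (Fin 2) (Fin 2) ℂ} (hb : b * b = 1) (htr : b.trace = 0)
    (hT : ∀ X, T X = (1 / 2 : ℂ) • (X.trace • 1 + (b * X).trace • b)) :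
    ∃ g : Matrix (Fin 2) (Fin 2) ℂ, IsUnit g.det ∧ T = columnProjection g := by
  -- The spectral projections of the involution b; each has trace 1 because b is traceless.
  refine exists_eq_columnProjection_of_idempotents (T := T)
    (e := ![(1 / 2 : ℂ) • (1 + b), (1 / 2 : ℂ) • (1 - b)]) ?_ ?_ ?_
  · have h1 : ((1 / 2 : ℂ) • (1 + b)) * ((1 / 2 : ℂ) • (1 + b)) = (1 / 2 : ℂ) • (1 + b) := by
      simp only [smul_mul_smul_comm, add_mul, mul_add, hb, one_mul, mul_one]
      module
    have h2 : ((1 / 2 : ℂ) • (1 - b)) * ((1 / 2 : ℂ) • (1 - b)) = (1 / 2 : ℂ) • (1 - b) := by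
      simp only [smul_mul_smul_comm, sub_mul, mul_sub, hb, one_mul, mul_one]
      module
    have h3 : ((1 / 2 : ℂ) • (1 + b)) * ((1 / 2 : ℂ) • (1 - b)) = 0 := by
      simp only [smul_mul_smul_comm, add_mul, mul_sub, hb, one_mul, mul_one]
      module
    have h4 : ((1 / 2 : ℂ) • (1 - b)) * ((1 / 2 : ℂ) • (1 + b)) = 0 := by
      simp only [smul_mul_smul_comm, sub_mul, mul_add, hb, one_mul, mul_one]
      module
    intro i j
    fin_cases i <;> fin_cases j
    exacts [h1.trans (if_pos rfl).symm, h3.trans (if_neg (by decide)).symm,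
      h4.trans (if_neg (by decide)).symm, h2.trans (if_pos rfl).symm]
  · intro i
    fin_cases i <;> simp [htr]
  · intro X
    simp only [hT, Fin.sum_univ_two, cons_val_zero, cons_val_one, smul_mul_assoc, add_mul, sub_mul,
      one_mul, trace_smul, trace_add, trace_sub]
    module

theorem cube_root_idempotent_mul {A : Type*} [Ring A] [Algebra ℂ A] {y : A} (hy : y ^ 3 = 1)
    (v w : ℂ) :
    ((1 / 3 : ℂ) • (1 + v • y + v ^ 2 • y ^ 2)) * ((1 / 3 : ℂ) • (1 + w • y + w ^ 2 • y ^ 2)) =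
      (1 / 9 : ℂ) • ((1 + v * w ^ 2 + v ^ 2 * w) • 1 + (v + w + v ^ 2 * w ^ 2) • y +
        (v ^ 2 + v * w + w ^ 2) • y ^ 2) := by
  have h12 : y * y ^ 2 = 1 := by rw [← hy]; noncomm_ring
  have h21 : y ^ 2 * y = 1 := by rw [← hy]; noncomm_ring
  have h22 : y ^ 2 * y ^ 2 = y := by
    calc y ^ 2 * y ^ 2 = y ^ 3 * y := by noncomm_ring
      _ = y := by rw [hy, one_mul]
  simp only [smul_mul_smul_comm, add_mul, mul_add, one_mul, mul_one, h12, h21, h22, ← pow_two]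
  module

theorem exists_eq_columnProjection_of_cube_eq_one
    {T : Matrix (Fin 3) (Fin 3) ℂ →ₗ[ℂ] Matrix (Fin 3) (Fin 3) ℂ}
    {y : Matrix (Fin 3) (Fin 3) ℂ} (hy : y ^ 3 = 1) (htr : y.trace = 0) (htr2 : (y ^ 2).trace = 0)
    (hT : ∀ X, T X = (1 / 3 : ℂ) • (X.trace • 1 + (y ^ 2 * X).trace • y +
      (y * X).trace • y ^ 2)) :
    ∃ g : Matrix (Fin 3) (Fin 3) ℂ, IsUnit g.det ∧ T = columnProjection g := by
  obtain ⟨ω, hω⟩ : ∃ ω : ℂ, ω ^ 2 + ω + 1 = 0 := by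
    have hp := (Complex.isPrimitiveRoot_exp 3 (by norm_num)).geom_sum_eq_zero (by norm_num)
    exact ⟨_, by rw [← hp]; simp [Finset.sum_range_succ]; ring⟩
  have hω3 : ω ^ 3 = 1 := by linear_combination (ω - 1) * hω
  have hd (v : ℂ) (hv : v ^ 3 = 1) :
      ((1 / 3 : ℂ) • (1 + v • y + v ^ 2 • y ^ 2)) * ((1 / 3 : ℂ) • (1 + v • y + v ^ 2 • y ^ 2)) =
        (1 / 3 : ℂ) • (1 + v • y + v ^ 2 • y ^ 2) := by
    have h1 : 1 + v * v ^ 2 + v ^ 2 * v = 3 := by linear_combination 2 * hv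
    have h2 : v + v + v ^ 2 * v ^ 2 = 3 * v := by linear_combination v * hv
    rw [cube_root_idempotent_mul hy, h1, h2]
    module
  -- For distinct cube roots of unity, the last condition is (v³ - w³)/(v - w) = 0.
  have ho (v w : ℂ) (hv : v ^ 3 = 1) (hw : w ^ 3 = 1) (h : v ^ 2 + v * w + w ^ 2 = 0) :
      ((1 / 3 : ℂ) • (1 + v • y + v ^ 2 • y ^ 2)) * ((1 / 3 : ℂ) • (1 + w • y + w ^ 2 • y ^ 2)) =
        0 := by
    have h1 : 1 + v * w ^ 2 + v ^ 2 * w = 0 := by linear_combination v * h - hv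
    have h2 : v + w + v ^ 2 * w ^ 2 = 0 := by
      linear_combination v ^ 2 * w ^ 2 * h1 - (v + w) * (w ^ 3 * hv + hw)
    rw [cube_root_idempotent_mul hy, h, h1, h2]
    simp
  -- The discrete Fourier transform of 1, y, y² gives the spectral projections of y.
  refine exists_eq_columnProjection_of_idempotents (T := T)
    (e := fun s => (1 / 3 : ℂ) • (1 + (ω ^ (s : ℕ)) • y + (ω ^ (s : ℕ)) ^ 2 • y ^ 2)) ?_ ?_ ?_
  · intro i j
    have hp (k : ℕ) : (ω ^ k) ^ 3 = 1 := by rw [← pow_mul, mul_comm, pow_mul, hω3, one_pow]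
    split_ifs with h
    · subst h
      exact hd _ (hp _)
    · refine ho _ _ (hp _) (hp _) ?_
      fin_cases i <;> fin_cases j <;> simp at h ⊢
      · linear_combination hω
      · linear_combination (ω ^ 2 - ω + 1) * hω
      · linear_combination hω
      · linear_combination ω ^ 2 * hω
      · linear_combination (ω ^ 2 - ω + 1) * hω
      · linear_combination ω ^ 2 * hω
  · intro i
    simp [htr, htr2]
  · intro X
    simp only [hT, Fin.sum_univ_three, smul_mul_assoc, add_mul, one_mul, trace_smul, trace_add,
      Fin.val_zero, Fin.val_one, Fin.val_two, smul_eq_mul]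
    match_scalars
    · linear_combination (-1 / 9 : ℂ) * ((y * X).trace + (y ^ 2 * X).trace * (ω ^ 2 - ω + 1)) * hω
    · linear_combination (-1 / 9 : ℂ) * (X.trace + (y * X).trace * (ω ^ 2 - ω + 1)) * hω -
        (1 / 9 : ℂ) * (y ^ 2 * X).trace * (ω ^ 3 + 2) * hω3
    · linear_combination (-1 / 9 : ℂ) * (X.trace + (y ^ 2 * X).trace * (ω ^ 4 - ω ^ 2 + 1)) *
        (ω ^ 2 - ω + 1) * hω - (1 / 9 : ℂ) * (y * X).trace * (ω ^ 3 + 2) * hω3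

/-- Cayley–Hamilton for a traceless 2 × 2 matrix. -/
theorem mul_self_eq_of_trace_eq_zero {a : Matrix (Fin 2) (Fin 2) ℂ} (ha : a.trace = 0) :
    a * a = ((a * a).trace / 2) • 1 := by
  rw [trace_fin_two] at ha
  have h : a 1 1 = -a 0 0 := by linear_combination ha
  ext i j
  fin_cases i <;> fin_cases j <;> simp [trace_fin_two, mul_apply, Fin.sum_univ_two, h] <;> ring

theorem exists_eq_columnProjection_two
    {T : Matrix (Fin 2) (Fin 2) ℂ →ₗ[ℂ] Matrix (Fin 2) (Fin 2) ℂ} (hT : T ∈ biprojectionSet 2 1) :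
    ∃ g : Matrix (Fin 2) (Fin 2) ℂ, IsUnit g.det ∧ T = columnProjection g := by
  obtain ⟨hT, hc⟩ := hT
  have hr : Module.finrank ℂ (LinearMap.range (tracelessPart T)) = 1 := by
    have := hT.finrank_range_tracelessPart hc
    omega
  obtain ⟨⟨a, ha⟩, ha0, hspan⟩ := finrank_eq_one_iff'.mp hr
  have ha0' : a ≠ 0 := fun h => ha0 (Subtype.ext h)
  have htp (X) : ∃ c : ℂ, c • a = tracelessPart T X := by
    obtain ⟨c, hc⟩ := hspan ⟨_, X, rfl⟩
    exact ⟨c, congrArg Subtype.val hc⟩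
  obtain ⟨hTa, htra⟩ := hT.mem_range_tracelessPart_iff.mp ha
  -- The trace form is nondegenerate on the line spanned by a.
  have ht : (a * a).trace ≠ 0 := by
    obtain ⟨Z, ⟨X, rfl⟩, hZ⟩ := hT.exists_trace_mul_eq ha ha0' 1
    obtain ⟨c, hc⟩ := htp X
    intro h0
    rw [← hc, mul_smul_comm, trace_smul, h0, smul_zero] at hZ
    exact zero_ne_one hZ
  obtain ⟨μ, hμ⟩ := IsAlgClosed.exists_pow_nat_eq (2 / (a * a).trace) zero_lt_two
  have hμ' : μ * μ * (a * a).trace = 2 := by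
    rw [← pow_two, hμ, div_mul_cancel₀ _ ht]
  refine exists_eq_columnProjection_of_sq_eq_one (b := μ • a) ?_ (by simp [htra]) fun X => ?_
  · rw [smul_mul_smul_comm, mul_self_eq_of_trace_eq_zero htra, smul_smul]
    rw [show μ * μ * ((a * a).trace / 2) = 1 by linear_combination hμ' / 2, one_smul]
  · obtain ⟨c, hc⟩ := htp X
    have h1 : c * (a * a).trace = (a * X).trace := by
      rw [← hT.trace_mul_tracelessPart ha X, ← hc, mul_smul_comm, trace_smul, smul_eq_mul]
    have h2 : T X = (X.trace / 2) • 1 + c • a := by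
      rw [hc, tracelessPart_apply]
      push_cast
      abel
    rw [h2, smul_mul_assoc, trace_smul, smul_eq_mul, ← h1]
    match_scalars
    · ring
    · linear_combination (-c / 2) * hμ'

namespace FrobeniusAlgebra.IsBiprojection

theorem exists_isotropic {T : Matrix (Fin n) (Fin n) ℂ →ₗ[ℂ] Matrix (Fin n) (Fin n) ℂ}
    (hr : Module.finrank ℂ (LinearMap.range (tracelessPart T)) = 2) :
    ∃ y ∈ LinearMap.range (tracelessPart T), y ≠ 0 ∧ (y * y).trace = 0 := by
  let B := Module.finBasisOfFinrankEq ℂ _ hr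
  have hli := LinearIndependent.pair_iff.mp
    (show LinearIndependent ℂ ![B 0, B 1] by
      convert B.linearIndependent
      ext i; fin_cases i <;> rfl)
  obtain ⟨⟨u, hu⟩, hB0⟩ : ∃ u, u = B 0 := ⟨_, rfl⟩
  obtain ⟨⟨v, hv⟩, hB1⟩ : ∃ u, u = B 1 := ⟨_, rfl⟩
  rw [← hB0, ← hB1] at hli
  by_cases h : (v * v).trace = 0
  · refine ⟨v, hv, ?_, h⟩
    rintro rfl
    simpa using hli 0 1 (by simp [Subtype.ext_iff])
  -- The polynomial is Tr((u + tv)²) as a function of t, of degree exactly 2.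
  · obtain ⟨t, ht⟩ := IsAlgClosed.exists_root
      (Polynomial.C (v * v).trace * Polynomial.X ^ 2 + Polynomial.C (2 * (u * v).trace) *
        Polynomial.X + Polynomial.C (u * u).trace) (by rw [Polynomial.degree_quadratic h]; decide)
    refine ⟨u + t • v, Submodule.add_mem _ hu (Submodule.smul_mem _ _ hv), fun h0 => ?_, ?_⟩
    · simpa using hli 1 t (by simpa [Subtype.ext_iff] using h0)
    · simp only [Polynomial.IsRoot, Polynomial.eval_add, Polynomial.eval_mul, Polynomial.eval_C,
        Polynomial.eval_pow, Polynomial.eval_X] at ht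
      simp only [add_mul, mul_add, smul_mul_assoc, mul_smul_comm, trace_add, trace_smul,
        smul_eq_mul, trace_mul_comm v u]
      linear_combination ht

/-- A hyperbolic pair in the traceless part of the range, and the resulting expression of `T`. -/
theorem exists_hyperbolic_pair [NeZero n]
    {T : Matrix (Fin n) (Fin n) ℂ →ₗ[ℂ] Matrix (Fin n) (Fin n) ℂ}
    (hT : (matrixFrobenius n).IsBiprojection T)
    (hr : Module.finrank ℂ (LinearMap.range (tracelessPart T)) = 2) :
    ∃ y z : Matrix (Fin n) (Fin n) ℂ, y ∈ LinearMap.range (tracelessPart T) ∧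
      z ∈ LinearMap.range (tracelessPart T) ∧ (y * y).trace = 0 ∧ (z * z).trace = 0 ∧
      (y * z).trace = 2 ∧
      ∀ X, tracelessPart T X = ((z * X).trace / 2) • y + ((y * X).trace / 2) • z := by
  obtain ⟨y, hy, hy0, hyy⟩ := exists_isotropic hr
  obtain ⟨z', hz', hyz'⟩ := hT.exists_trace_mul_eq hy hy0 2
  obtain ⟨z, hz, hyz, hzz⟩ : ∃ z ∈ LinearMap.range (tracelessPart T), (y * z).trace = 2 ∧
      (z * z).trace = 0 := by
    -- As Tr(y²) = 0 and Tr(yz') = 2, this multiple of y cancels Tr(z'²) and preserves the pairing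
    -- with y.
    refine ⟨z' - ((z' * z').trace / 4) • y, Submodule.sub_mem _ hz' (Submodule.smul_mem _ _ hy),
      ?_, ?_⟩
    · simp [mul_sub, hyy, hyz']
    · simp only [sub_mul, mul_sub, smul_mul_assoc, mul_smul_comm, trace_sub, trace_smul,
        smul_eq_mul, trace_mul_comm z' y, hyz', hyy]
      ring
  refine ⟨y, z, hy, hz, hyy, hzz, hyz, fun X => ?_⟩
  have hzy : (z * y).trace = 2 := by rw [trace_mul_comm, hyz]
  have hli : LinearIndependent ℂ
      ![(⟨y, hy⟩ : LinearMap.range (tracelessPart T)), ⟨z, hz⟩] := by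
    rw [LinearIndependent.pair_iff]
    intro s t hst
    have h : s • y + t • z = 0 := congrArg Subtype.val hst
    have h1 := congrArg (fun m => (z * m).trace) h
    have h2 := congrArg (fun m => (y * m).trace) h
    simp [mul_add, hyy, hzz, hyz, hzy] at h1 h2
    exact ⟨h1, h2⟩
  have hspan := hli.span_eq_top_of_card_eq_finrank (by simp [hr])
  have hmem : (⟨tracelessPart T X, X, rfl⟩ : LinearMap.range (tracelessPart T)) ∈
      Submodule.span ℂ (Set.range ![(⟨y, hy⟩ : LinearMap.range (tracelessPart T)), ⟨z, hz⟩]) := by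
    rw [hspan]; trivial
  rw [range_cons_cons_empty, Submodule.mem_span_pair] at hmem
  obtain ⟨s, t, hst⟩ := hmem
  have h : s • y + t • z = tracelessPart T X := congrArg Subtype.val hst
  have h1 := hT.trace_mul_tracelessPart hz X
  have h2 := hT.trace_mul_tracelessPart hy X
  rw [← h] at h1 h2
  simp only [mul_add, mul_smul_comm, trace_add, trace_smul, smul_eq_mul, hzy, hzz, hyy, hyz] at h1 h2
  rw [← h, ← h1, ← h2]
  module

end FrobeniusAlgebra.IsBiprojection

theorem exists_eq_columnProjection_three
    {T : Matrix (Fin 3) (Fin 3) ℂ →ₗ[ℂ] Matrix (Fin 3) (Fin 3) ℂ} (hT : T ∈ biprojectionSet 3 1) :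
    ∃ g : Matrix (Fin 3) (Fin 3) ℂ, IsUnit g.det ∧ T = columnProjection g := by
  obtain ⟨hT, hc⟩ := hT
  obtain ⟨y, z, hy, hz, hyy, hzz, hyz, htp⟩ := hT.exists_hyperbolic_pair (by
    have := hT.finrank_range_tracelessPart hc
    omega)
  obtain ⟨hTy, htry⟩ := hT.mem_range_tracelessPart_iff.mp hy
  obtain ⟨hTz, htrz⟩ := hT.mem_range_tracelessPart_iff.mp hz
  have hzy : (z * y).trace = 2 := by rw [trace_mul_comm, hyz]
  have hTX (X) : T X = (X.trace / 3) • 1 + ((z * X).trace / 2) • y + ((y * X).trace / 2) • z := by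
    rw [add_assoc, ← htp, tracelessPart_apply]
    push_cast
    abel
  -- The equation T * T = T, expanded along 1, y, z; its values at X = 1 and X = z determine the
  -- algebra generated by y and z.
  have hconv (X) : (1 / 3 : ℂ) • T X + (1 / 2 : ℂ) • (y * T (z * X)) +
      (1 / 2 : ℂ) • (z * T (y * X)) = T X := by
    have h := DFunLike.congr_fun hc X
    rw [matrixFrobenius_conv_eq_sum T T ![1, y, z]
      ![(1 / 3 : ℂ) • 1, (1 / 2 : ℂ) • z, (1 / 2 : ℂ) • y] (fun X => by
        rw [hTX, Fin.sum_univ_three]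
        simp [div_eq_inv_mul]), Fin.sum_univ_three] at h
    simpa using h
  have hanti : y * z + z * y = (4 / 3 : ℂ) • 1 := by
    have h := hconv 1
    simp only [hT.unital, mul_one, hTy, hTz] at h
    linear_combination (norm := module) (2 : ℂ) • h
  -- Since y and z are traceless, the anticommutation relation kills all mixed cubic traces.
  have hyyz : (y * (y * z)).trace = 0 := by
    have h := congrArg (fun m => (y * m).trace) hanti
    simp only [mul_add, trace_add, mul_smul_comm, mul_one, trace_smul, htry, smul_zero] at h
    rw [← mul_assoc y z y, trace_mul_comm (y * z) y] at h
    linear_combination h / 2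
  have hzzy : (z * (z * y)).trace = 0 := by
    have h := congrArg (fun m => (z * m).trace) hanti
    simp only [mul_add, trace_add, mul_smul_comm, mul_one, trace_smul, htrz, smul_zero] at h
    rw [← mul_assoc z y z, trace_mul_comm (z * y) z] at h
    linear_combination h / 2
  have hyzy : (y * (z * y)).trace = 0 := by rw [← mul_assoc, trace_mul_comm, hyyz]
  have hzyz : (z * (y * z)).trace = 0 := by rw [← mul_assoc, trace_mul_comm, hzzy]
  have hzyy : (z * (y * y)).trace = 0 := by rw [← mul_assoc, trace_mul_comm, hyzy]
  have hyzz : (y * (z * z)).trace = 0 := by rw [← mul_assoc, trace_mul_comm, hzyz]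
  have hy1 : ((y * (y * y)).trace / 4) • (z * z) = (1 / 3 : ℂ) • y := by
    have h := hconv y
    rw [hTy, hTX (z * y), hTX (y * y), hzy, hyy, hzzy, hyzy, hzyy] at h
    simp only [mul_add, mul_smul_comm, mul_one] at h
    linear_combination (norm := module) h
  -- Without mixed traces, the value at z makes z a multiple of y². So z commutes with y, yz is
  -- scalar, and y³ is scalar.
  have hz1 : ((z * (z * z)).trace / 4) • (y * y) = (1 / 3 : ℂ) • z := by
    have h := hconv z
    rw [hTz, hTX (z * z), hTX (y * z), hyz, hzz, hyyz, hzyz, hyzz] at h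
    simp only [mul_add, mul_smul_comm, mul_one] at h
    linear_combination (norm := module) h
  set β := (z * (z * z)).trace / 4 with hβ
  have hz2 : z = (3 * β) • (y * y) := by linear_combination (norm := module) (-3 : ℂ) • hz1
  have hcomm : z * y = y * z := by
    rw [hz2]
    simp [mul_assoc]
  have hyz1 : y * z = (2 / 3 : ℂ) • 1 := by
    rw [hcomm] at hanti
    linear_combination (norm := module) (1 / 2 : ℂ) • hanti
  have hβ0 : β ≠ 0 := by
    intro h
    rw [hz2, h] at hyz
    simp at hyz
  have hy3 : y ^ 3 = (2 / (9 * β)) • 1 := by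
    rw [hz2, mul_smul_comm] at hyz1
    have h : (9 * β) • y ^ 3 = (2 : ℂ) • 1 := by
      rw [pow_succ', pow_two]
      linear_combination (norm := module) (3 : ℂ) • hyz1
    rw [div_eq_inv_mul, mul_smul, ← h, smul_smul, inv_mul_cancel₀ (by simpa using hβ0), one_smul]
  -- The inverse of the scalar y³, so that (μy)³ = 1.
  obtain ⟨μ, hμ⟩ := IsAlgClosed.exists_pow_nat_eq (9 * β / 2) zero_lt_three
  have hμ0 : μ ≠ 0 := by
    rintro rfl
    rw [zero_pow three_ne_zero, eq_comm, div_eq_zero_iff] at hμ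
    simp [hβ0] at hμ
  refine exists_eq_columnProjection_of_cube_eq_one (y := μ • y) ?_ (by simp [htry]) ?_ fun X => ?_
  · rw [smul_pow, hy3, smul_smul, hμ]
    rw [show 9 * β / 2 * (2 / (9 * β)) = 1 by field_simp, one_smul]
  · rw [smul_pow, pow_two y, trace_smul, hyy, smul_zero]
  · rw [hTX, hz2]
    simp only [smul_pow, pow_two y, smul_mul_assoc, trace_smul, smul_eq_mul]
    match_scalars
    · ring
    · linear_combination (-1 / 3 : ℂ) * (y * y * X).trace * hμ
    · linear_combination (-1 / 3 : ℂ) * (y * X).trace * hμ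

end Classification

/-! ### Parametrization by matrices with unit diagonal. -/

section Coordinates

variable {n : ℕ}

/-- The coordinates of the projection attached to the columns of `g`, over an arbitrary ring. -/
noncomputable def columnCoords {R : Type*} [CommRing R] (g : Matrix (Fin n) (Fin n) R)
    (p : Fin n × Fin n × Fin n × Fin n) : R :=
  ∑ s, columnIdempotent g s p.2.1 p.1 * columnIdempotent g s p.2.2.1 p.2.2.2

theorem endCoords_columnProjection (g : Matrix (Fin n) (Fin n) ℂ) :
    endCoords (columnProjection g) = columnCoords g := by
  funext ⟨i, j, k, l⟩
  simp [endCoords, columnProjection_apply, columnCoords, Matrix.sum_apply, trace_mul_single]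

/-- Inverses commute with ring homomorphisms; this lets the generic matrix be specialized to complex
ones. -/
theorem map_columnIdempotent {R S : Type*} [CommRing R] [CommRing S] (f : R →+* S)
    {g : Matrix (Fin n) (Fin n) R} (hg : IsUnit g.det) (s : Fin n) :
    columnIdempotent (g.map f) s = (columnIdempotent g s).map f := by
  have h : (g.map f)⁻¹ = g⁻¹.map f := by
    apply inv_eq_left_inv
    rw [← Matrix.map_mul, nonsing_inv_mul _ hg, Matrix.map_one _ (map_zero f) (map_one f)]
  ext i j
  simp [columnIdempotent_apply, h]

theorem map_columnCoords {R S : Type*} [CommRing R] [CommRing S] (f : R →+* S)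
    {g : Matrix (Fin n) (Fin n) R} (hg : IsUnit g.det) (p : Fin n × Fin n × Fin n × Fin n) :
    columnCoords (g.map f) p = f (columnCoords g p) := by
  simp [columnCoords, map_columnIdempotent f hg]

/-- The matrix with ones on the diagonal and the entries `c` off the diagonal. -/
def normalizedMatrix {R : Type*} [CommRing R] (c : {p : Fin n × Fin n // p.1 ≠ p.2} → R) :
    Matrix (Fin n) (Fin n) R :=
  of fun i j => if h : i = j then 1 else c ⟨(i, j), h⟩

theorem map_normalizedMatrix {R S : Type*} [CommRing R] [CommRing S] (f : R →+* S)
    (c : {p : Fin n × Fin n // p.1 ≠ p.2} → R) :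
    (normalizedMatrix c).map f = normalizedMatrix (f ∘ c) := by
  ext i j
  simp only [normalizedMatrix, map_apply, of_apply, Function.comp_apply]
  split_ifs <;> simp

theorem normalizedMatrix_zero {R : Type*} [CommRing R] :
    normalizedMatrix (0 : {p : Fin n × Fin n // p.1 ≠ p.2} → R) = 1 := by
  ext i j
  simp [normalizedMatrix, one_apply]

/-- Scaling a column preserves its idempotent, and permuting columns permutes the summands. The
entries in a nonzero term of the Leibniz expansion can thus be moved to the diagonal and made 1. -/
theorem exists_normalizedMatrix {g : Matrix (Fin n) (Fin n) ℂ} (hg : IsUnit g.det) :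
    ∃ c : {p : Fin n × Fin n // p.1 ≠ p.2} → ℂ, IsUnit (normalizedMatrix c).det ∧
      columnProjection g = columnProjection (normalizedMatrix c) := by
  obtain ⟨σ, hσ⟩ : ∃ σ : Equiv.Perm (Fin n), ∀ i, g (σ i) i ≠ 0 := by
    by_contra! h
    refine hg.ne_zero ?_
    rw [det_apply]
    refine Finset.sum_eq_zero fun σ _ => ?_
    obtain ⟨i, hi⟩ := h σ
    have h0 : ∏ i, g (σ i) i = 0 := Finset.prod_eq_zero (Finset.mem_univ i) hi
    exact (congrArg _ h0).trans (smul_zero _)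
  have hσ' (j : Fin n) : g j (σ.symm j) ≠ 0 := by simpa using hσ (σ.symm j)
  let u : Matrix (Fin n) (Fin n) ℂ := of fun i j => g i (σ.symm j) * (g j (σ.symm j))⁻¹
  -- The inverse of u: the rows of g⁻¹, permuted and rescaled inversely to the columns of g.
  let w : Matrix (Fin n) (Fin n) ℂ := of fun i j => g i (σ.symm i) * g⁻¹ (σ.symm i) j
  have hwu : w * u = 1 := by
    ext s t
    have h : (g⁻¹ * g) (σ.symm s) (σ.symm t) = if s = t then 1 else 0 := by
      rw [nonsing_inv_mul _ hg, one_apply]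
      simp
    have h2 : (w * u) s t =
        g s (σ.symm s) * (g t (σ.symm t))⁻¹ * (g⁻¹ * g) (σ.symm s) (σ.symm t) := by
      simp only [mul_apply, Finset.mul_sum, w, u, of_apply]
      exact Finset.sum_congr rfl fun i _ => by ring
    rw [h2, h, one_apply]
    split_ifs with hst
    · subst hst
      rw [mul_one, mul_inv_cancel₀ (hσ' s)]
    · rw [mul_zero]
  have hu : u = normalizedMatrix fun p => u p.1.1 p.1.2 := by
    ext i j
    rw [normalizedMatrix, of_apply]
    split_ifs with h
    · subst h
      exact mul_inv_cancel₀ (hσ' i)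
    · rfl
  refine ⟨fun p => u p.1.1 p.1.2, ?_, ?_⟩
  · rw [← hu]
    exact isUnit_det_of_left_inverse hwu
  · rw [← hu]
    have hcol (s : Fin n) : columnIdempotent u s = columnIdempotent g (σ.symm s) := by
      ext i j
      rw [columnIdempotent_apply, columnIdempotent_apply, inv_eq_left_inv hwu]
      have := hσ' s
      simp only [u, w, of_apply]
      field_simp
    ext1 X
    rw [columnProjection_apply, columnProjection_apply]
    simp_rw [hcol]
    exact (Equiv.sum_comp σ.symm fun s =>
      (columnIdempotent g s * X).trace • columnIdempotent g s).symm

theorem image_endCoords_eq_of_forall_exists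
    (h : ∀ T ∈ biprojectionSet n 1, ∃ g : Matrix (Fin n) (Fin n) ℂ,
      IsUnit g.det ∧ T = columnProjection g) :
    endCoords '' biprojectionSet n 1 =
      {x | ∃ c : {p : Fin n × Fin n // p.1 ≠ p.2} → ℂ,
        IsUnit (normalizedMatrix c).det ∧ x = columnCoords (normalizedMatrix c)} := by
  ext x
  constructor
  · rintro ⟨T, hT, rfl⟩
    obtain ⟨g, hg, rfl⟩ := h T hT
    obtain ⟨c, hc, hgc⟩ := exists_normalizedMatrix hg
    exact ⟨c, hc, by rw [hgc, endCoords_columnProjection]⟩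
  · rintro ⟨c, hc, rfl⟩
    exact ⟨_, columnProjection_mem_biprojectionSet hc, endCoords_columnProjection _⟩

end Coordinates

/-! ### Evaluation of elements of ℂ[x][1/D] at points where D ≠ 0. -/

section Localization

variable {σ : Type*}

theorem MvPolynomial.localizationAway_isAlgebraic (D : MvPolynomial σ ℂ) (hD : D ≠ 0) :
    Algebra.IsAlgebraic (MvPolynomial σ ℂ) (Localization.Away D) := by
  have hle : Submonoid.powers D ≤ nonZeroDivisors (MvPolynomial σ ℂ) :=
    powers_le_nonZeroDivisors_of_noZeroDivisors hD
  have : IsDomain (Localization.Away D) := IsLocalization.isDomain_localization hle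
  refine ⟨fun x => ?_⟩
  obtain ⟨k, a, hx⟩ := IsLocalization.Away.surj D x
  have hu : IsUnit (algebraMap (MvPolynomial σ ℂ) (Localization.Away D) D) :=
    IsLocalization.Away.algebraMap_isUnit D
  refine IsAlgebraic.of_mul (y := algebraMap _ _ D ^ k)
    (mem_nonZeroDivisors_of_ne_zero (hu.pow k).ne_zero) ?_ ?_
  · rw [← map_pow]
    exact isAlgebraic_algebraMap _
  · rw [mul_comm, hx]
    exact isAlgebraic_algebraMap _

theorem MvPolynomial.exists_localizationAway_eval (D : MvPolynomial σ ℂ) (c : σ → ℂ)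
    (hc : aeval c D ≠ 0) : ∃ φ : Localization.Away D →ₐ[ℂ] ℂ,
      ∀ p : MvPolynomial σ ℂ, φ (algebraMap _ _ p) = aeval c p := by
  have hunit (y : Submonoid.powers D) : IsUnit (aeval c (y : MvPolynomial σ ℂ)) := by
    obtain ⟨_, k, rfl⟩ := y
    simpa using fun h => absurd h hc
  exact ⟨IsLocalization.liftAlgHom (M := Submonoid.powers D) (f := aeval c) hunit, fun p => by
    rw [IsLocalization.liftAlgHom_apply]
    exact IsLocalization.lift_eq _ _⟩

/-- Writing x = a/D^k, the polynomial aD vanishes at every point: by hypothesis where D ≠ 0,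
trivially elsewhere. -/
theorem MvPolynomial.localizationAway_eq_zero (D : MvPolynomial σ ℂ) (x : Localization.Away D)
    (hx : ∀ c : σ → ℂ, aeval c D ≠ 0 → ∀ φ : Localization.Away D →ₐ[ℂ] ℂ,
      (∀ p : MvPolynomial σ ℂ, φ (algebraMap _ _ p) = aeval c p) → φ x = 0) : x = 0 := by
  obtain ⟨k, a, ha⟩ := IsLocalization.Away.surj D x
  have hu : IsUnit (algebraMap (MvPolynomial σ ℂ) (Localization.Away D) D) :=
    IsLocalization.Away.algebraMap_isUnit D
  have haD : a * D = 0 := by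
    refine MvPolynomial.funext fun c => ?_
    rw [map_mul, map_zero]
    by_cases hc : aeval c D = 0
    · rw [← coe_aeval_eq_eval, RingHom.coe_coe, hc, mul_zero]
    · obtain ⟨φ, hφ⟩ := exists_localizationAway_eval D c hc
      have h := congrArg φ ha
      rw [map_mul, hx c hc φ hφ, zero_mul, hφ] at h
      rw [← coe_aeval_eq_eval, RingHom.coe_coe, ← h, zero_mul]
  have h := congrArg (algebraMap (MvPolynomial σ ℂ) (Localization.Away D)) haD
  rwa [map_mul, ← ha, map_zero, hu.mul_left_eq_zero, (hu.pow k).mul_left_eq_zero] at h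

end Localization

/-! ### Dimension of the set of coordinates. -/

section Dimension

variable {n : ℕ}

/-- An entry of a column idempotent is an eigenvalue of a matrix whose entries are coordinates of
the associated projection. -/
theorem isIntegral_columnIdempotent {A B : Type*} [CommRing A] [CommRing B] [Algebra A B]
    {g : Matrix (Fin n) (Fin n) B} (hg : IsUnit g.det)
    (hA : ∀ p, columnCoords g p ∈ (algebraMap A B).range) (s i j : Fin n) :
    IsIntegral A (columnIdempotent g s i j) := by
  choose a ha using hA
  set M : Matrix (Fin n) (Fin n) A := of fun k l => a (j, i, k, l)
  have hM : M.map (algebraMap A B) = ∑ t, columnIdempotent g t i j • columnIdempotent g t := by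
    ext k l
    simp [M, ha, columnCoords, Matrix.sum_apply]
  refine ⟨M.charpoly, M.charpoly_monic, ?_⟩
  rw [← Polynomial.eval_map, ← charpoly_map, eval_charpoly]
  set N := scalar (Fin n) (columnIdempotent g s i j) - M.map (algebraMap A B) with hN
  -- By orthogonality, the image of M multiplies e_s by its entry at (i, j).
  have h0 : N * columnIdempotent g s = 0 := by
    rw [hN, sub_mul, hM, Finset.sum_mul]
    simp [columnIdempotent_mul hg, ← smul_eq_diagonal_mul]
  -- The adjugate replaces an eigenvector argument, so B need not be a domain; since Tr(e_s) = 1,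
  -- the determinant vanishes.
  have h1 : N.det • columnIdempotent g s = 0 := by
    rw [← Matrix.one_mul (columnIdempotent g s), ← smul_mul_assoc, ← adjugate_mul, mul_assoc, h0,
      mul_zero]
  simpa [trace_columnIdempotent hg] using congrArg trace h1

theorem affineDim_image_endCoords
    (h : ∀ T ∈ biprojectionSet n 1, ∃ g : Matrix (Fin n) (Fin n) ℂ,
      IsUnit g.det ∧ T = columnProjection g) :
    affineDim (endCoords '' biprojectionSet n 1) =
      (Fintype.card {p : Fin n × Fin n // p.1 ≠ p.2} : ℕ) := by
  obtain ⟨D, hD⟩ : ∃ D : MvPolynomial {p : Fin n × Fin n // p.1 ≠ p.2} ℂ,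
    D = (normalizedMatrix MvPolynomial.X).det := ⟨_, rfl⟩
  have hDc (c : {p : Fin n × Fin n // p.1 ≠ p.2} → ℂ) :
      MvPolynomial.aeval c D = (normalizedMatrix c).det := by
    rw [hD, ← AlgHom.coe_toRingHom, RingHom.map_det, RingHom.mapMatrix_apply, map_normalizedMatrix]
    congr 2
    funext p
    simp
  have hD0' : MvPolynomial.aeval (0 : {p : Fin n × Fin n // p.1 ≠ p.2} → ℂ) D ≠ 0 := by
    rw [hDc, normalizedMatrix_zero, det_one]
    exact one_ne_zero
  have hD0 : D ≠ 0 := by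
    intro h0
    rw [h0, map_zero] at hD0'
    exact hD0' rfl
  have : IsDomain (Localization.Away D) := IsLocalization.isDomain_localization
    (powers_le_nonZeroDivisors_of_noZeroDivisors hD0)
  let x : {p : Fin n × Fin n // p.1 ≠ p.2} → Localization.Away D :=
    algebraMap (MvPolynomial _ ℂ) (Localization.Away D) ∘ MvPolynomial.X
  let U : Matrix (Fin n) (Fin n) (Localization.Away D) := normalizedMatrix x
  have hU : IsUnit U.det := by
    have hdet := congrArg (algebraMap _ (Localization.Away D)) hD
    rw [RingHom.map_det, RingHom.mapMatrix_apply, map_normalizedMatrix] at hdet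
    rw [show U.det = algebraMap _ _ D from hdet.symm]
    exact IsLocalization.Away.algebraMap_isUnit D
  have hUφ (c) (φ : Localization.Away D →ₐ[ℂ] ℂ)
      (hφ : ∀ p : MvPolynomial _ ℂ, φ (algebraMap _ _ p) = MvPolynomial.aeval c p) :
      U.map (φ : Localization.Away D →+* ℂ) = normalizedMatrix c := by
    rw [map_normalizedMatrix]
    congr 1
    funext p
    simp [x, hφ]
  -- Pull-back of polynomials along the parametrization by the generic matrix U; its range is the
  -- coordinate ring.
  let ψ : MvPolynomial (Fin n × Fin n × Fin n × Fin n) ℂ →ₐ[ℂ] Localization.Away D :=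
    MvPolynomial.aeval (columnCoords U)
  have hφψ (c) (φ : Localization.Away D →ₐ[ℂ] ℂ)
      (hφ : ∀ p : MvPolynomial _ ℂ, φ (algebraMap _ _ p) = MvPolynomial.aeval c p) (q) :
      φ (ψ q) = MvPolynomial.aeval (columnCoords (normalizedMatrix c)) q := by
    rw [← AlgHom.comp_apply]
    congr 1
    refine MvPolynomial.algHom_ext fun p => ?_
    rw [AlgHom.comp_apply, MvPolynomial.aeval_X, MvPolynomial.aeval_X, ← hUφ c φ hφ]
    exact (map_columnCoords _ hU p).symm
  have hker : MvPolynomial.vanishingIdeal ℂ (endCoords '' biprojectionSet n 1) =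
      RingHom.ker ψ := by
    ext q
    rw [MvPolynomial.mem_vanishingIdeal_iff, RingHom.mem_ker,
      image_endCoords_eq_of_forall_exists h]
    constructor
    · intro hq
      refine MvPolynomial.localizationAway_eq_zero D _ fun c hc φ hφ => ?_
      rw [hφψ c φ hφ]
      exact hq _ ⟨c, by rwa [isUnit_iff_ne_zero, ← hDc], rfl⟩
    · rintro hq _ ⟨c, hc, rfl⟩
      obtain ⟨φ, hφ⟩ := MvPolynomial.exists_localizationAway_eval D c (by rw [hDc]; exact hc.ne_zero)
      rw [← hφψ c φ hφ, hq, map_zero]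
  have hcoords (p) : columnCoords U p ∈ (algebraMap ψ.range (Localization.Away D)).range :=
    ⟨⟨columnCoords U p, MvPolynomial.X p, MvPolynomial.aeval_X _ _⟩, rfl⟩
  have halgMv := MvPolynomial.localizationAway_isAlgebraic D hD0
  have hinj : Function.Injective
      (algebraMap (MvPolynomial {p : Fin n × Fin n // p.1 ≠ p.2} ℂ) (Localization.Away D)) :=
    IsLocalization.injective _ (powers_le_nonZeroDivisors_of_noZeroDivisors hD0)
  have : FaithfulSMul (MvPolynomial {p : Fin n × Fin n // p.1 ≠ p.2} ℂ) (Localization.Away D) :=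
    (faithfulSMul_iff_algebraMap_injective _ _).mpr hinj
  have hx : IsTranscendenceBasis ℂ x :=
    (IsTranscendenceBasis.mvPolynomial _ ℂ).algebraMap_comp
  have halg : Algebra.IsAlgebraic ψ.range (Localization.Away D) := by
    -- It suffices to treat the variables. As U has unit diagonal, x_{is} = e_s(i,s)/e_s(s,s), with
    -- both entries integral over the range.
    rw [hx.isAlgebraic_iff (S := ψ.range)]
    rintro ⟨⟨i, s⟩, his⟩
    have hs := (isIntegral_columnIdempotent hU hcoords s s s).isAlgebraic
    have hi := (isIntegral_columnIdempotent hU hcoords s i s).isAlgebraic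
    have hUs : U s s = 1 := by simp [U, normalizedMatrix]
    have hUi : U i s = x ⟨(i, s), his⟩ := dif_neg his
    refine IsAlgebraic.of_mul (mem_nonZeroDivisors_of_ne_zero ?_) hs ?_
    · intro h0
      -- At the origin U becomes the identity matrix, where this entry is 1.
      obtain ⟨φ, hφ⟩ := MvPolynomial.exists_localizationAway_eval D 0 hD0'
      have h1 := congrFun (congrFun (map_columnIdempotent (φ : _ →+* ℂ) hU s) s) s
      rw [hUφ 0 φ hφ, normalizedMatrix_zero, map_apply, h0, map_zero, columnIdempotent_apply] at h1
      simp at h1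
    · convert hi using 1
      rw [columnIdempotent_apply, columnIdempotent_apply, hUs, hUi]
      ring
  have htr : Algebra.trdeg ℂ ψ.range = Fintype.card {p : Fin n × Fin n // p.1 ≠ p.2} := by
    have : FaithfulSMul ℂ ψ.range :=
      (faithfulSMul_iff_algebraMap_injective _ _).mpr (algebraMap ℂ ψ.range).injective
    have h1 := trdeg_add_eq ℂ ψ.range (A := Localization.Away D)
    rw [trdeg_eq_zero (R := ψ.range), add_zero, ← hx.cardinalMk_eq_trdeg, Cardinal.mk_fintype] at h1
    exact h1
  have : Algebra.FiniteType ℂ ψ.range :=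
    Algebra.FiniteType.of_surjective ψ.rangeRestrict ψ.rangeRestrict_surjective
  rw [affineDim, hker, ← ringKrullDim_eq_of_trdeg_eq ℂ ψ.range _ htr]
  exact ringKrullDim_eq_of_ringEquiv (Ideal.quotientKerEquivRange ψ).toRingEquiv

end Dimension

/-! ### Cardinality of the set of biprojections. -/

section Cardinality

variable {n : ℕ}

theorem endCoords_injective : Function.Injective
    (endCoords : (Matrix (Fin n) (Fin n) ℂ →ₗ[ℂ] Matrix (Fin n) (Fin n) ℂ) → _) := by
  intro S T h
  refine Matrix.ext_linearMap ℂ fun i j => ?_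
  ext1
  ext k l
  exact congrFun h (i, j, k, l)

theorem endCoords_surjective : Function.Surjective
    (endCoords : (Matrix (Fin n) (Fin n) ℂ →ₗ[ℂ] Matrix (Fin n) (Fin n) ℂ) → _) := by
  intro x
  refine ⟨(stdBasis ℂ (Fin n) (Fin n)).constr ℂ fun p => of fun k l => x (p.1, p.2, k, l), ?_⟩
  funext ⟨i, j, k, l⟩
  have h := (stdBasis ℂ (Fin n) (Fin n)).constr_basis ℂ
    (fun p => (of fun k l => x (p.1, p.2, k, l) : Matrix (Fin n) (Fin n) ℂ)) (i, j)
  rw [stdBasis_eq_single] at h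
  exact congrFun (congrFun h k) l

/-- This coordinate recovers t, so distinct transvections along (i, j) give distinct biprojections.
-/
theorem columnCoords_transvection {i j : Fin n} (hij : i ≠ j) (t : ℂ) :
    columnCoords (transvection i j t) (i, i, i, j) = -t := by
  have hinv : (transvection i j t)⁻¹ = transvection i j (-t) := by
    apply inv_eq_left_inv
    rw [transvection_mul_transvection_same _ _ hij, neg_add_cancel, transvection_zero]
  rw [columnCoords, Finset.sum_eq_single i]
  · simp only [columnIdempotent_apply, hinv]
    simp [transvection, hij, hij.symm]
  · intro s _ hs
    simp only [columnIdempotent_apply, hinv]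
    by_cases hsj : s = j
    · subst hsj
      simp [transvection, hs, hs.symm]
    · simp [transvection, hs.symm, Ne.symm hsj]
  · simp

theorem mk_biprojectionSet_one {i j : Fin n} (hij : i ≠ j) :
    Cardinal.mk (biprojectionSet n 1) = Cardinal.continuum := by
  apply le_antisymm
  · refine (Cardinal.mk_le_of_injective
      (endCoords_injective.comp Subtype.val_injective)).trans ?_
    rw [Cardinal.mk_arrow, Cardinal.lift_id, Cardinal.lift_id, Cardinal.mk_complex,
      Cardinal.mk_fintype]
    exact_mod_cast Cardinal.power_nat_le Cardinal.aleph0_le_continuum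
  · rw [← Cardinal.mk_complex]
    have hdet (t : ℂ) : IsUnit (transvection i j t).det := by
      rw [det_transvection_of_ne i j hij]
      exact isUnit_one
    refine Cardinal.mk_le_of_injective (f := fun t => (⟨columnProjection (transvection i j t),
      columnProjection_mem_biprojectionSet (hdet t)⟩ : biprojectionSet n 1)) fun s t hst => ?_
    have h := congrFun (congrArg endCoords (congrArg Subtype.val hst)) (i, i, i, j)
    simp only [endCoords_columnProjection, columnCoords_transvection hij] at h
    exact neg_injective h

end Cardinality

/-! ### Polynomial equations for the biprojections with constant 1. -/

section Algebraic

theorem IsAffineAlgebraicSet.setOf_forall_eval_eq {ι κ : Type*} (p q : κ → MvPolynomial ι ℂ) :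
    IsAffineAlgebraicSet {x | ∀ k, MvPolynomial.eval x (p k) = MvPolynomial.eval x (q k)} := by
  refine ⟨Set.range fun k => p k - q k, ?_⟩
  ext x
  simp [sub_eq_zero]

theorem IsAffineAlgebraicSet.inter {ι : Type*} {S T : Set (ι → ℂ)} (hS : IsAffineAlgebraicSet S)
    (hT : IsAffineAlgebraicSet T) : IsAffineAlgebraicSet (S ∩ T) := by
  obtain ⟨P, rfl⟩ := hS
  obtain ⟨Q, rfl⟩ := hT
  refine ⟨P ∪ Q, ?_⟩
  ext x
  simp only [Set.mem_inter_iff, Set.mem_ofPred_eq, Set.mem_union]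
  exact ⟨fun h p hp => hp.elim (h.1 p) (h.2 p), fun h => ⟨fun p hp => h p (.inl hp),
    fun p hp => h p (.inr hp)⟩⟩

variable {n : ℕ} (T : Matrix (Fin n) (Fin n) ℂ →ₗ[ℂ] Matrix (Fin n) (Fin n) ℂ)

theorem dual_eq_self_iff_endCoords : (matrixFrobenius n).dual T = T ↔
    ∀ p : Fin n × Fin n × Fin n × Fin n,
      endCoords T (p.2.2.2, p.2.2.1, p.2.1, p.1) = endCoords T p := by
  rw [← endCoords_injective.eq_iff, funext_iff]
  refine forall_congr' fun ⟨i, j, k, l⟩ => ?_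
  have h : endCoords ((matrixFrobenius n).dual T) (i, j, k, l) = endCoords T (l, k, j, i) := by
    simp only [endCoords, matrixFrobenius_dual_apply, Matrix.sum_apply, Matrix.smul_apply,
      trace_single_mul]
    rw [Finset.sum_eq_single l, Finset.sum_eq_single k]
    · simp
    · intro b _ hb
      simp [hb]
    · simp
    · intro b _ hb
      exact Finset.sum_eq_zero fun a _ => by simp [hb]
    · simp
  rw [h]

theorem apply_one_eq_one_iff_endCoords : T 1 = 1 ↔ ∀ q : Fin n × Fin n,
    ∑ i, endCoords T (i, i, q.1, q.2) = (1 : Matrix (Fin n) (Fin n) ℂ) q.1 q.2 := by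
  rw [← Matrix.ext_iff, Prod.forall]
  refine forall_congr' fun k => forall_congr' fun l => ?_
  conv_lhs => rw [← sum_single_one, map_sum, Matrix.sum_apply]
  rw [sum_single_one]
  rfl

theorem comp_self_eq_self_iff_endCoords : T ∘ₗ T = T ↔
    ∀ p : Fin n × Fin n × Fin n × Fin n,
      ∑ a, ∑ b, endCoords T (p.1, p.2.1, a, b) * endCoords T (a, b, p.2.2.1, p.2.2.2) =
        endCoords T p := by
  rw [← endCoords_injective.eq_iff, funext_iff]
  refine forall_congr' fun ⟨i, j, k, l⟩ => ?_
  have h : endCoords (T ∘ₗ T) (i, j, k, l) =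
      ∑ a, ∑ b, endCoords T (i, j, a, b) * endCoords T (a, b, k, l) := by
    have h1 (X : Matrix (Fin n) (Fin n) ℂ) : T X = ∑ a, ∑ b, X a b • T (single a b 1) := by
      conv_lhs => rw [matrix_eq_sum_single X]
      simp only [map_sum, ← map_smul, smul_single, smul_eq_mul, mul_one]
    change T (T (single i j 1)) k l = _
    rw [h1]
    simp [Matrix.sum_apply, endCoords]
  rw [h]

theorem conv_self_eq_self_iff_endCoords : (matrixFrobenius n).conv T T = (1 : ℂ) • T ↔
    ∀ p : Fin n × Fin n × Fin n × Fin n,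
      ∑ q : Fin n × Fin n, endCoords T (p.1, q.2, p.2.2.1, q.1) *
        endCoords T (q.2, p.2.1, q.1, p.2.2.2) = endCoords T p := by
  rw [← endCoords_injective.eq_iff, funext_iff, one_smul]
  refine forall_congr' fun ⟨i, j, k, l⟩ => ?_
  -- Through Choi matrices, the convolution square is a matrix square, hence quadratic in the
  -- coordinates.
  have h := congrFun (congrFun (choiMatrix_conv T T) (k, i)) (l, j)
  rw [mul_apply] at h
  rw [show endCoords ((matrixFrobenius n).conv T T) (i, j, k, l) = _ from h]
  rfl

theorem isAffineAlgebraicSet_endCoords_image (n : ℕ) :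
    IsAffineAlgebraicSet (endCoords '' biprojectionSet n 1) := by
  have h : endCoords '' biprojectionSet n 1 =
      ({x | ∀ p : Fin n × Fin n × Fin n × Fin n, x (p.2.2.2, p.2.2.1, p.2.1, p.1) = x p} ∩
      {x | ∀ q : Fin n × Fin n,
        ∑ i, x (i, i, q.1, q.2) = (1 : Matrix (Fin n) (Fin n) ℂ) q.1 q.2}) ∩
      ({x | ∀ p : Fin n × Fin n × Fin n × Fin n,
        ∑ a, ∑ b, x (p.1, p.2.1, a, b) * x (a, b, p.2.2.1, p.2.2.2) = x p} ∩
      {x | ∀ p : Fin n × Fin n × Fin n × Fin n, ∑ q : Fin n × Fin n,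
        x (p.1, q.2, p.2.2.1, q.1) * x (q.2, p.2.1, q.1, p.2.2.2) = x p}) := by
    ext x
    obtain ⟨T, rfl⟩ := endCoords_surjective x
    rw [endCoords_injective.mem_set_image]
    simp only [Set.mem_inter_iff, Set.mem_ofPred_eq, ← dual_eq_self_iff_endCoords,
      ← apply_one_eq_one_iff_endCoords, ← comp_self_eq_self_iff_endCoords,
      ← conv_self_eq_self_iff_endCoords]
    -- Fixing the constant to 1 removes both the existential and the condition that it be nonzero.
    exact ⟨fun h => ⟨⟨h.1.selfdual, h.1.unital⟩, h.1.idempotent, h.2⟩,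
      fun h => ⟨⟨h.1.1, h.1.2, h.2.1, 1, one_ne_zero, h.2.2⟩, h.2.2⟩⟩
  rw [h]
  refine .inter (.inter ?_ ?_) (.inter ?_ ?_)
  · convert IsAffineAlgebraicSet.setOf_forall_eval_eq
      (fun p : Fin n × Fin n × Fin n × Fin n =>
        MvPolynomial.X (p.2.2.2, p.2.2.1, p.2.1, p.1)) MvPolynomial.X with x p
    all_goals simp
  · convert IsAffineAlgebraicSet.setOf_forall_eval_eq
      (fun q : Fin n × Fin n => ∑ i : Fin n, MvPolynomial.X (i, i, q.1, q.2))
      (fun q => MvPolynomial.C ((1 : Matrix (Fin n) (Fin n) ℂ) q.1 q.2)) with x p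
    all_goals simp
  · convert IsAffineAlgebraicSet.setOf_forall_eval_eq
      (fun p : Fin n × Fin n × Fin n × Fin n => ∑ a, ∑ b,
        MvPolynomial.X (p.1, p.2.1, a, b) * MvPolynomial.X (a, b, p.2.2.1, p.2.2.2))
      MvPolynomial.X with x p
    all_goals simp
  · convert IsAffineAlgebraicSet.setOf_forall_eval_eq
      (fun p : Fin n × Fin n × Fin n × Fin n => ∑ q : Fin n × Fin n,
        MvPolynomial.X (p.1, q.2, p.2.2.1, q.1) * MvPolynomial.X (q.2, p.2.1, q.1, p.2.2.2))
      MvPolynomial.X with x p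
    all_goals simp

end Algebraic

end Matrices

theorem proposition3p10 :
    (∀ n : ℕ, 1 ≤ n → n ≤ 3 →
      -- the constant of any biprojection is `1 / n`, `1` or `n`
      (∀ T : Matrix (Fin n) (Fin n) ℂ →ₗ[ℂ] Matrix (Fin n) (Fin n) ℂ,
        (matrixFrobenius n).IsBiprojection T →
        ∀ c : ℂ, (matrixFrobenius n).conv T T = c • T →
          c = 1 / (n : ℂ) ∨ c = 1 ∨ c = (n : ℂ)) ∧
      -- the unique biprojection with constant `1 / n` is the normalized trace map
      (∃! T, T ∈ biprojectionSet n (1 / (n : ℂ))) ∧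
      (∀ T ∈ biprojectionSet n (1 / (n : ℂ)), ∀ X, T X = ((1 / (n : ℂ)) * X.trace) • 1) ∧
      -- the unique biprojection with constant `n` is the identity map
      (∃! T, T ∈ biprojectionSet n (n : ℂ)) ∧
      (∀ T ∈ biprojectionSet n (n : ℂ), ∀ X, T X = X)) ∧
    -- the biprojections with constant `1`, for `n = 2` and `n = 3`
    (Cardinal.mk (biprojectionSet 2 1) = Cardinal.continuum ∧
      IsAffineAlgebraicSet (endCoords '' biprojectionSet 2 1) ∧
      affineDim (endCoords '' biprojectionSet 2 1) = 2) ∧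
    (Cardinal.mk (biprojectionSet 3 1) = Cardinal.continuum ∧
      IsAffineAlgebraicSet (endCoords '' biprojectionSet 3 1) ∧
      affineDim (endCoords '' biprojectionSet 3 1) = 6) := by
  refine ⟨fun n h1 h3 => ?_, ⟨?_, ?_, ?_⟩, ?_, ?_, ?_⟩
  · have : NeZero n := ⟨by omega⟩
    have hn : n = 1 ∨ n.Prime := by
      interval_cases n
      exacts [.inl rfl, .inr Nat.prime_two, .inr Nat.prime_three]
    refine ⟨fun T hT c hc => hT.scalar_cases hn hc, ?_, ?_, ?_, ?_⟩
    · refine ⟨_, trace_mem_biprojectionSet, fun T hT => ?_⟩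
      ext1 X
      rw [hT.1.eq_trace_of_scalar_eq hT.2]
      simp [smul_smul]
    · exact fun T hT X => hT.1.eq_trace_of_scalar_eq hT.2 X
    · exact ⟨_, id_mem_biprojectionSet, fun T hT =>
        LinearMap.ext fun X => hT.1.eq_id_of_scalar_eq hT.2 X⟩
    · exact fun T hT X => hT.1.eq_id_of_scalar_eq hT.2 X
  · exact mk_biprojectionSet_one (i := 0) (j := 1) (by decide)
  · exact isAffineAlgebraicSet_endCoords_image 2
  · rw [affineDim_image_endCoords fun T hT => exists_eq_columnProjection_two hT,
      show Fintype.card {p : Fin 2 × Fin 2 // p.1 ≠ p.2} = 2 by decide]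
    rfl
  · exact mk_biprojectionSet_one (i := 0) (j := 1) (by decide)
  · exact isAffineAlgebraicSet_endCoords_image 3
  · rw [affineDim_image_endCoords fun T hT => exists_eq_columnProjection_three hT,
      show Fintype.card {p : Fin 3 × Fin 3 // p.1 ≠ p.2} = 6 by decide]
    rfl
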